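/- **Proposition 3.1.** Let $N\ge 5$, $2^*=\frac{2N}{N-4}$ and $K\in C^1(\mathbb R^N)\cap L^\infty(\mathbb R^N)$. Let $\mathcal D^{2,2}(\mathbb R^N)\subset L^{2^*}(\mathbb R^N)$ be the completion of $C_0^\infty(\mathbb R^N)$ with respect to the norm $\|u\|=\big(\int_{\mathbb R^N}|\Delta u|^2\big)^{1/2}$, and for $\varepsilon>0$ and $u\in\mathcal D^{2,2}(\mathbb R^N)$ put $$I_\varepsilon(u)=\frac12\int_{\mathbb R^N}|\Delta u|^2-\frac1{2^*}\int_{\mathbb R^N}(1+\varepsilon K)|u|^{2^*}.$$ For $y\in\mathbb R^N$ and $\lambda>0$ let $$U_{y,\lambda}(x)=C_N\frac{\lambda^{\frac{N-4}2}}{(1+\lambda^2|x-y|^2)^{\frac{N-4}2}},\qquad C_N=[(N-4)(N-2)N(N+2)]^{\frac{N-4}8}.$$ Let $z^1\ne z^2$ be critical points of $K$ such that for $j=1,2$, after a suitable rotation of the coordinate system depending on $z^j$, $$K(x)=K(z^j)+\sum_{i=1}^N a_i^j|x_i-z_i^j|^{\beta_j}+O\big(|x-z^j|^{\beta_j+\sigma_j}\big)\quad\text{for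 } x \text{ near } z^j,$$ where $a_i^j\neq0$ for all $i$, $\sum_{i}a_i^j<0$, $\beta_j\in(1,N-4)$ and $\sigma_j\in(0,1)$. For all $\varepsilon\in(0,\varepsilon_1)$, where $\varepsilon_1>0$, let $$u_\varepsilon=\alpha_{1,\varepsilon}U_{y^1_\varepsilon,\lambda_{1,\varepsilon}}+\alpha_{2,\varepsilon}U_{y^2_\varepsilon,\lambda_{2,\varepsilon}}+v_\varepsilon,\qquad v_\varepsilon\in\mathcal D^{2,2}(\mathbb R^N),$$ where $\alpha_{j,\varepsilon}\to1$, $y^j_\varepsilon\to z^j$ and $\lambda_{j,\varepsilon}\to+\infty$ as $\varepsilon\to0^+$, for $j=1,2$. Suppose that $u_\varepsilon$ is a critical point of $I_\varepsilon$ in $\mathcal D^{2,2}(\mathbb R^N)$ for every $\varepsilon\in(0,\varepsilon_1)$, and that, for some constant $\tau>0$, $$\|v_\varepsilon\|=O\Big(\varepsilon\sum_{j=1}^2\Big(|y^j_\varepsilon-z^j|^{\beta_j}+\lambda_{j,\varepsilon}^{-\theta_j}\Big)+\varepsilon_{12}^{\frac12+\tau}\Big)\quad\text{as }\varepsilon\to0^+,$$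 where $\theta_j=\min\{\beta_j,\frac{N+4}2\}$ and $\varepsilon_{12}=(\lambda_{1,\varepsilon}\lambda_{2,\varepsilon})^{-\frac{N-4}2}$. Then there is $\varepsilon_0\in(0,\varepsilon_1]$ such that $u_\varepsilon>0$ for every $\varepsilon\in(0,\varepsilon_0)$, that is, $u_\varepsilon>0$ almost everywhere in $\mathbb R^N$, and every continuous representative of $u_\varepsilon$ is positive at every point of $\mathbb R^N$. -/

import Mathlib

open MeasureTheory Filter Topology Asymptotics Set
open scoped ContDiff Laplacian

namespace BiharmonicCritical

/-- Euclidean space `ℝ^N` (with the Euclidean norm). -/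
abbrev RN (N : ℕ) : Type := EuclideanSpace ℝ (Fin N)

/-- The critical exponent `2^* = 2N/(N-4)`. -/
noncomputable def critExp (N : ℕ) : ℝ := 2 * (N : ℝ) / ((N : ℝ) - 4)

/-- `u` lies in `𝒟^{2,2}(ℝ^N)` and `g` is its Laplacian.  The space `𝒟^{2,2}(ℝ^N)`, the completion
of `C_c^∞(ℝ^N)` for the norm `‖Δ φ‖_{L^2}`, is realised inside `L^{2^*}(ℝ^N)` (into which it embeds
for `N ≥ 5`): the pair `(u, g)` is a limit in `L^{2^*} × L^2` of pairs `(φ_n, Δ φ_n)` with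
`φ_n ∈ C_c^∞`. The function `g` is determined by `u` almost everywhere. -/
def HasD22Laplacian {N : ℕ} (u g : RN N → ℝ) : Prop :=
  MemLp u (ENNReal.ofReal (critExp N)) volume ∧ MemLp g 2 volume ∧
    ∃ φ : ℕ → RN N → ℝ,
      (∀ n, ContDiff ℝ ∞ (φ n) ∧ HasCompactSupport (φ n)) ∧
      Tendsto (fun n => eLpNorm (φ n - u) (ENNReal.ofReal (critExp N)) volume) atTop (𝓝 0) ∧
      Tendsto (fun n => eLpNorm (Δ (φ n) - g) 2 volume) atTop (𝓝 0)

/-- Membership in `𝒟^{2,2}(ℝ^N)`. -/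
def MemD22 {N : ℕ} (u : RN N → ℝ) : Prop := ∃ g, HasD22Laplacian u g

open Classical in
/-- The Laplacian `Δ u ∈ L^2` of `u ∈ 𝒟^{2,2}(ℝ^N)` (a representative; zero outside that space). -/
noncomputable def lap {N : ℕ} (u : RN N → ℝ) : RN N → ℝ :=
  if h : MemD22 u then h.choose else 0

/-- The norm `‖u‖ = (∫ |Δ u|²)^{1/2}` of `𝒟^{2,2}(ℝ^N)`. -/
noncomputable def normD22 {N : ℕ} (u : RN N → ℝ) : ℝ := Real.sqrt (∫ x, (lap u x) ^ 2)

/-- The functional `I_ε(u) = ½ ∫ |Δ u|² - (1/2^*) ∫ (1 + ε K) |u|^{2^*}`. -/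
noncomputable def energy {N : ℕ} (K : RN N → ℝ) (ε : ℝ) (u : RN N → ℝ) : ℝ :=
  1 / 2 * (∫ x, (lap u x) ^ 2) - 1 / critExp N * ∫ x, (1 + ε * K x) * |u x| ^ critExp N

/-- `u ∈ 𝒟^{2,2}(ℝ^N)` is a critical point of `I_ε`: the Fréchet derivative of `I_ε` on the normed
space `𝒟^{2,2}(ℝ^N)` exists at `u` and vanishes, i.e. `I_ε(u + φ) - I_ε(u) = o(‖φ‖)`. -/
def IsCriticalPoint {N : ℕ} (K : RN N → ℝ) (ε : ℝ) (u : RN N → ℝ) : Prop :=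
  MemD22 u ∧ ∀ η > 0, ∃ δ > 0, ∀ φ : RN N → ℝ, MemD22 φ → normD22 φ ≤ δ →
    |energy K ε (u + φ) - energy K ε u| ≤ η * normD22 φ

/-- The constant `C_N = [(N-4)(N-2)N(N+2)]^{(N-4)/8}`. -/
noncomputable def bubbleConst (N : ℕ) : ℝ :=
  (((N : ℝ) - 4) * ((N : ℝ) - 2) * (N : ℝ) * ((N : ℝ) + 2)) ^ (((N : ℝ) - 4) / 8)

/-- The bubble `U_{y,l}(x) = C_N l^{(N-4)/2} / (1 + l² |x - y|²)^{(N-4)/2}`. -/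
noncomputable def bubble {N : ℕ} (y : RN N) (l : ℝ) (x : RN N) : ℝ :=
  bubbleConst N * l ^ (((N : ℝ) - 4) / 2) / (1 + l ^ 2 * ‖x - y‖ ^ 2) ^ (((N : ℝ) - 4) / 2)

/-- `α_1 U_{y^1,l_1} + α_2 U_{y^2,l_2} + v`. -/
noncomputable def twoPeak {N : ℕ} (α : Fin 2 → ℝ) (y : Fin 2 → RN N) (l : Fin 2 → ℝ)
    (v : RN N → ℝ) : RN N → ℝ :=
  fun x => (∑ j, α j * bubble (y j) (l j) x) + v x

/-- `z` belongs to the set `Σ` of critical points of `K`, with exponent `β`: in the coordinates of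
some orthonormal basis `b` (a rotation of the coordinate system depending on `z`),
`K(x) = K(z) + ∑ a_i |x_i - z_i|^β + O(|x - z|^{β + σ})` near `z`. -/
def MemSigma {N : ℕ} (K : RN N → ℝ) (z : RN N) (β : ℝ) : Prop :=
  fderiv ℝ K z = 0 ∧ 1 < β ∧ β < (N : ℝ) - 4 ∧
    ∃ (b : OrthonormalBasis (Fin N) ℝ (RN N)) (a : Fin N → ℝ) (σ : ℝ),
      0 < σ ∧ σ < 1 ∧ (∀ i, a i ≠ 0) ∧ ∑ i, a i < 0 ∧
      (fun x => K x - (K z + ∑ i, a i * |inner ℝ (b i) (x - z)| ^ β)) =O[𝓝 z]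
        (fun x => ‖x - z‖ ^ (β + σ))

/-- `ε_{12} = (l_1 l_2)^{-(N-4)/2}`. -/
noncomputable def interaction (N : ℕ) (l : Fin 2 → ℝ) : ℝ :=
  1 / (l 0 * l 1) ^ (((N : ℝ) - 4) / 2)

/-- The right-hand side of the estimate on the remainder:
`ε ∑_j (|y^j - z^j|^{β_j} + l_j^{-θ_j}) + ε_{12}^{1/2 + τ}`, `θ_j = min {β_j, (N+4)/2}`. -/
noncomputable def remainderBound {N : ℕ} (z : Fin 2 → RN N) (β : Fin 2 → ℝ) (τ ε : ℝ)
    (y : Fin 2 → RN N) (l : Fin 2 → ℝ) : ℝ :=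
  ε * (∑ j, (‖y j - z j‖ ^ β j + 1 / l j ^ min (β j) (((N : ℝ) + 4) / 2)))
    + interaction N l ^ (1 / 2 + τ)

end BiharmonicCritical

/-! Write q for the critical exponent. For small ε the weight k = 1 + εK lies between 1/2 and 2, and
the remainder v is small in L^q by the Sobolev inequality. A critical point u solves Δ²u =
k|u|^{q-2}u weakly. Since the bubbles are positive, the negative part u⁻ is at most |v|, so a =
‖u⁻‖_q is small. It remains to show that a small negative part vanishes and that a nonnegative
nonzero solution is positive.

The truncation u⁻ need not belong to the second-order space, so it is not used as a test function.
Instead, Riesz representation gives w with Δ²w = k(u⁻)^{q-1}, and w ≥ 0 by the minimum principle.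
Evaluating ∫ Δu Δw with the equation of w gives at most -a^q/2; evaluating it with the equation of u
gives at least -‖Δw‖², because w ≥ 0. Hence a^q/2 ≤ ‖Δw‖² ≤ (2C a^{q-1})², with C the Sobolev
constant, and small a must be 0 (`exists_ae_nonneg_of_negPart_small`).

Positivity for Δ² comes from applying twice the principle that a superharmonic function in L^p, 1 ≤
p < ∞, is nonnegative: first to -Δw in L², then to w in L^q. Its proof uses smooth weighted means
over balls. They increase as the ball shrinks, tend to 0 as the radius grows, and recover the
function almost everywhere as the radius tends to 0. The same monotonicity gives the strong version
(`IsSuperharmonic.ae_pos`), which makes u positive once u is nonzero. Finally, u = 0 would force |v|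
to dominate half a bubble, whose L^q norm is bounded below independently of centre and
concentration. -/

namespace BiharmonicCritical

/-! ### The Laplacian in coordinates -/

/-- The standard orthonormal basis of `ℝ^N`. -/
noncomputable abbrev stdBasis (N : ℕ) : OrthonormalBasis (Fin N) ℝ (RN N) :=
  EuclideanSpace.basisFun (Fin N) ℝ

/-- The partial derivative `∂_i f`. -/
noncomputable def partialDeriv {N : ℕ} (i : Fin N) (f : RN N → ℝ) : RN N → ℝ :=
  fun x => fderiv ℝ f x (stdBasis N i)

theorem contDiff_partialDeriv {N : ℕ} {f : RN N → ℝ} (hf : ContDiff ℝ ∞ f) (i : Fin N) :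
    ContDiff ℝ ∞ (partialDeriv i f) :=
  (hf.fderiv_right (m := ∞) (by simp)).clm_apply contDiff_const

theorem hasCompactSupport_partialDeriv {N : ℕ} {f : RN N → ℝ} (hf : HasCompactSupport f)
    (i : Fin N) : HasCompactSupport (partialDeriv i f) :=
  (hf.fderiv (𝕜 := ℝ)).comp_left (g := fun L : RN N →L[ℝ] ℝ => L (stdBasis N i)) (by simp)

theorem laplacian_eq_sum_partialDeriv {N : ℕ} {f : RN N → ℝ} (hf : ContDiff ℝ ∞ f) :
    Δ f = fun x => ∑ i, partialDeriv i (partialDeriv i f) x := by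
  rw [InnerProductSpace.laplacian_eq_iteratedFDeriv_orthonormalBasis f (stdBasis N)]
  funext x
  refine Finset.sum_congr rfl fun i _ => ?_
  rw [iteratedFDeriv_two_apply]
  have h : DifferentiableAt ℝ (fderiv ℝ f) x :=
    ((hf.fderiv_right (m := ∞) (by simp)).differentiable (by simp)).differentiableAt
  unfold partialDeriv
  rw [fderiv_clm_apply h (differentiableAt_const _)]
  simp

theorem contDiff_laplacian {N : ℕ} {f : RN N → ℝ} (hf : ContDiff ℝ ∞ f) :
    ContDiff ℝ ∞ (Δ f) := by
  rw [laplacian_eq_sum_partialDeriv hf]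
  exact ContDiff.sum fun i _ => contDiff_partialDeriv (contDiff_partialDeriv hf i) i

theorem hasCompactSupport_laplacian {N : ℕ} {f : RN N → ℝ} (hf : ContDiff ℝ ∞ f)
    (hc : HasCompactSupport f) : HasCompactSupport (Δ f) := by
  refine HasCompactSupport.intro hc fun x hx => ?_
  rw [laplacian_eq_sum_partialDeriv hf]
  refine Finset.sum_eq_zero fun i _ => ?_
  have h : f =ᶠ[𝓝 x] 0 := notMem_tsupport_iff_eventuallyEq.1 hx
  have h2 : fderiv ℝ f =ᶠ[𝓝 x] fderiv ℝ (0 : RN N → ℝ) := h.fderiv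
  have h3 : partialDeriv i f =ᶠ[𝓝 x] 0 := by
    filter_upwards [h2] with z hz
    simp [partialDeriv, hz]
  simp [partialDeriv, h3.fderiv_eq]

/-- With ρ = m²|z - x|² one has Δρ = 2Nm² and |∇ρ|² = 4m²ρ; the formula is B'Δρ + B''|∇ρ|². -/
theorem laplacian_comp_normSq {N : ℕ} {B B' B'' : ℝ → ℝ} (hB : ContDiff ℝ ∞ B)
    (hB' : ∀ r, HasDerivAt B (B' r) r) (hB'' : ∀ r, HasDerivAt B' (B'' r) r) (m : ℝ)
    (x y : RN N) :
    Δ (fun z : RN N => B (m ^ 2 * ‖z - x‖ ^ 2)) y =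
      m ^ 2 * (2 * N * B' (m ^ 2 * ‖y - x‖ ^ 2)
        + 4 * (m ^ 2 * ‖y - x‖ ^ 2) * B'' (m ^ 2 * ‖y - x‖ ^ 2)) := by
  have hρ : ∀ z : RN N, HasFDerivAt (fun z : RN N => m ^ 2 * ‖z - x‖ ^ 2)
      ((m ^ 2) • ((2 : ℕ) • (innerSL ℝ) (z - x))) z := by
    intro z
    have := (((hasFDerivAt_id z).sub_const x).norm_sq).const_mul (m ^ 2)
    simpa using this
  have hsm : ContDiff ℝ ∞ (fun z : RN N => B (m ^ 2 * ‖z - x‖ ^ 2)) :=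
    hB.comp (contDiff_const.mul ((contDiff_id.sub contDiff_const).norm_sq ℝ))
  have hcoord : ∀ (z : RN N) (i : Fin N), inner ℝ (z - x) (stdBasis N i) = z i - x i := by
    intro z i
    simp [EuclideanSpace.inner_single_right]
  have h1 : ∀ i : Fin N, partialDeriv i (fun z : RN N => B (m ^ 2 * ‖z - x‖ ^ 2)) =
      fun z => B' (m ^ 2 * ‖z - x‖ ^ 2) * (2 * m ^ 2 * (z i - x i)) := by
    intro i
    funext z
    have := (hB' (m ^ 2 * ‖z - x‖ ^ 2)).comp_hasFDerivAt z (hρ z)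
    have h := this.fderiv
    simp only [Function.comp_def] at h
    rw [partialDeriv, h]
    simp only [smul_apply, innerSL_apply_apply, hcoord, smul_eq_mul,
      nsmul_eq_mul]
    push_cast; ring
  have h2 : ∀ (i : Fin N) , partialDeriv i (partialDeriv i
      (fun z : RN N => B (m ^ 2 * ‖z - x‖ ^ 2))) y =
      m ^ 2 * (2 * B' (m ^ 2 * ‖y - x‖ ^ 2)
        + 4 * (m ^ 2 * (y i - x i) ^ 2) * B'' (m ^ 2 * ‖y - x‖ ^ 2)) := by
    intro i
    rw [h1 i]
    have ha := (hB'' (m ^ 2 * ‖y - x‖ ^ 2)).comp_hasFDerivAt y (hρ y)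
    have hb : HasFDerivAt (fun z : RN N => 2 * m ^ 2 * (z i - x i))
        ((2 * m ^ 2) • (EuclideanSpace.proj i : RN N →L[ℝ] ℝ)) y := by
      have := ((EuclideanSpace.proj i : RN N →L[ℝ] ℝ).hasFDerivAt (x := y)).sub_const (x i)
      exact this.const_mul _
    have h := (ha.mul hb).fderiv
    simp only [Function.comp_def] at h
    unfold partialDeriv
    erw [h]
    simp only [add_apply, smul_apply,
      innerSL_apply_apply, hcoord, smul_eq_mul, nsmul_eq_mul]
    simp
    ring
  rw [laplacian_eq_sum_partialDeriv hsm]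
  simp only [h2]
  have hnorm : ‖y - x‖ ^ 2 = ∑ i, (y i - x i) ^ 2 := by
    rw [EuclideanSpace.norm_sq_eq]
    simp
  rw [← Finset.mul_sum, Finset.sum_add_distrib]
  congr 1
  congr 1
  · simp; ring
  · rw [← Finset.sum_mul, ← Finset.mul_sum, ← Finset.mul_sum, hnorm]

/-! ### The profile of the averaging kernels -/

/-- The profile `b(r) = e'(1 - r)`, with `e = expNegInvGlue`; it vanishes for `r ≥ 1`. -/
noncomputable def profile (r : ℝ) : ℝ := deriv expNegInvGlue (1 - r)

theorem hasDerivAt_expNegInvGlue (x : ℝ) :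
    HasDerivAt expNegInvGlue ((x⁻¹) ^ 2 * expNegInvGlue x) x := by
  have := expNegInvGlue.hasDerivAt_polynomial_eval_inv_mul 1 x
  simpa using this

theorem profile_eq (r : ℝ) : profile r = ((1 - r)⁻¹) ^ 2 * expNegInvGlue (1 - r) :=
  (hasDerivAt_expNegInvGlue _).deriv

theorem contDiff_profile : ContDiff ℝ ∞ profile := by
  have h : ContDiff ℝ ∞ (deriv expNegInvGlue) :=
    (contDiff_succ_iff_deriv (n := ∞).1 (expNegInvGlue.contDiff (n := ⊤))).2.2
  exact h.comp (contDiff_const.sub contDiff_id)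

theorem profile_nonneg (r : ℝ) : 0 ≤ profile r := by
  rw [profile_eq]; exact mul_nonneg (sq_nonneg _) (expNegInvGlue.nonneg _)

theorem profile_pos {r : ℝ} (hr : r < 1) : 0 < profile r := by
  rw [profile_eq]
  have : 0 < 1 - r := by linarith
  exact mul_pos (by positivity) (expNegInvGlue.pos_of_pos this)

theorem profile_eq_zero {r : ℝ} (hr : 1 ≤ r) : profile r = 0 := by
  rw [profile_eq, expNegInvGlue.zero_of_nonpos (by linarith), mul_zero]

theorem hasDerivAt_profile (r : ℝ) : HasDerivAt profile (deriv profile r) r :=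
  (contDiff_profile.differentiable (by simp) r).hasDerivAt

theorem deriv_profile_eq_zero {r : ℝ} (hr : 1 ≤ r) : deriv profile r = 0 := by
  rcases hr.eq_or_lt with rfl | h
  -- At the endpoint r = 1 the nonnegative profile attains its minimum 0, so the derivative vanishes
  -- there too.
  · have : IsLocalMin profile 1 := by
      refine Eventually.of_forall fun s => ?_
      rw [profile_eq_zero le_rfl]; exact profile_nonneg s
    exact this.deriv_eq_zero
  · have : profile =ᶠ[𝓝 r] fun _ => 0 := by
      filter_upwards [eventually_gt_nhds h] with s hs using profile_eq_zero hs.le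
    rw [this.deriv_eq]; simp

/-- A function bounded on `[0,1]` and vanishing on `[1,∞)` is bounded on `[0,∞)`. -/
theorem exists_bound_of_eq_zero_of_one_le {f : ℝ → ℝ} (hf : Continuous f)
    (h0 : ∀ r, 1 ≤ r → f r = 0) : ∃ C, 0 < C ∧ ∀ r, 0 ≤ r → |f r| ≤ C := by
  obtain ⟨C, hC⟩ := isCompact_Icc.exists_bound_of_continuousOn (s := Icc (0 : ℝ) 1) hf.continuousOn
  refine ⟨max C 1, by positivity, fun r hr => ?_⟩
  rcases le_total r 1 with h | h
  · exact (hC r ⟨hr, h⟩).trans (le_max_left _ _)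
  · rw [h0 r h]; simp

theorem continuous_deriv_profile : Continuous (deriv profile) :=
  contDiff_profile.continuous_deriv (by simp)

/-- `m ↦ m^N b(m²ρ)` has derivative `m^{N-1} (N b + 2 ρ b')`. -/
noncomputable def profileDeriv (N : ℕ) (r : ℝ) : ℝ := N * profile r + 2 * r * deriv profile r

theorem continuous_profileDeriv (N : ℕ) : Continuous (profileDeriv N) := by
  unfold profileDeriv
  have h1 := contDiff_profile.continuous
  have h2 := continuous_deriv_profile
  fun_prop

theorem profileDeriv_eq_zero (N : ℕ) {r : ℝ} (hr : 1 ≤ r) : profileDeriv N r = 0 := by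
  simp [profileDeriv, profile_eq_zero hr, deriv_profile_eq_zero hr]

theorem hasDerivAt_kernel {N : ℕ} (hN : N ≠ 0) (s m : ℝ) :
    HasDerivAt (fun m : ℝ => m ^ N * profile (m ^ 2 * s))
      (m ^ (N - 1) * profileDeriv N (m ^ 2 * s)) m := by
  have h1 : HasDerivAt (fun m : ℝ => m ^ 2 * s) (2 * m * s) m := by
    simpa using (hasDerivAt_pow 2 m).mul_const s
  have h2 := (hasDerivAt_profile (m ^ 2 * s)).comp m h1
  have h3 := (hasDerivAt_pow N m).mul h2
  refine h3.congr_deriv ?_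
  obtain ⟨n, rfl⟩ := Nat.exists_eq_succ_of_ne_zero hN
  simp only [profileDeriv, Function.comp, Nat.succ_eq_add_one, Nat.add_sub_cancel]
  ring

/-- The nonnegative test function whose Laplacian is minus the derivative of the kernels. -/
theorem contDiff_potential {N : ℕ} (m : ℝ) (x : RN N) :
    ContDiff ℝ ∞ (fun z : RN N => expNegInvGlue (1 - m ^ 2 * ‖z - x‖ ^ 2)) :=
  (expNegInvGlue.contDiff (n := ⊤)).comp
    (contDiff_const.sub (contDiff_const.mul ((contDiff_id.sub contDiff_const).norm_sq ℝ)))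

theorem notMem_closedBall_iff_one_lt {N : ℕ} {m : ℝ} (hm : 0 < m) (x z : RN N) :
    z ∉ Metric.closedBall x (1 / m) ↔ 1 < m ^ 2 * ‖z - x‖ ^ 2 := by
  rw [Metric.mem_closedBall, not_le, dist_eq_norm, div_lt_iff₀ hm, ← mul_pow]
  rw [mul_comm m, one_lt_sq_iff₀ (by positivity)]

theorem hasCompactSupport_comp_normSq {N : ℕ} {f : ℝ → ℝ} (h0 : ∀ r, 1 ≤ r → f r = 0) {m : ℝ}
    (hm : 0 < m) (x : RN N) : HasCompactSupport (fun z : RN N => f (m ^ 2 * ‖z - x‖ ^ 2)) :=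
  HasCompactSupport.intro (isCompact_closedBall x (1 / m)) fun z hz =>
    h0 _ ((notMem_closedBall_iff_one_lt hm x z).1 hz).le

/-- This identity dictates the choice of profile. The primitive of -b that vanishes beyond 1 is a
nonnegative test function, and its Laplacian carries the same factor N b + 2ρb' as the m-derivative
of the kernels m^N b(m²|y - x|²). Monotonicity of the means in m thus follows from superharmonicity
tested against this one family. -/
theorem laplacian_potential {N : ℕ} (m : ℝ) (x y : RN N) :
    Δ (fun z : RN N => expNegInvGlue (1 - m ^ 2 * ‖z - x‖ ^ 2)) y =
      -(2 * m ^ 2 * profileDeriv N (m ^ 2 * ‖y - x‖ ^ 2)) := by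
  have hd : ∀ r : ℝ, HasDerivAt (fun r => expNegInvGlue (1 - r)) (-profile r) r := by
    intro r
    have h1 : HasDerivAt (fun r : ℝ => 1 - r) (-1) r := by
      simpa using (hasDerivAt_id r).const_sub 1
    have := (hasDerivAt_expNegInvGlue (1 - r)).comp r h1
    rw [← profile_eq] at this
    simpa [Function.comp_def] using this
  have := laplacian_comp_normSq (N := N) (B := fun r => expNegInvGlue (1 - r))
    ((expNegInvGlue.contDiff (n := ⊤)).comp (contDiff_const.sub contDiff_id)) hd
    (fun r => (hasDerivAt_profile r).neg) m x y
  rw [this, profileDeriv]; ring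

end BiharmonicCritical

namespace BiharmonicCritical

/-! ### Superharmonic functions -/

/-- `-Δ g ≥ 0` in the sense of distributions. -/
def IsSuperharmonic {N : ℕ} (g : RN N → ℝ) : Prop :=
  ∀ φ : RN N → ℝ, ContDiff ℝ ∞ φ → HasCompactSupport φ → (∀ x, 0 ≤ φ x) →
    ∫ x, g x * Δ φ x ≤ 0

/-- The weighted mean of `g` over the ball of radius `1 / m` around `x` (up to a constant). -/
noncomputable def kernelMean {N : ℕ} (m : ℝ) (x : RN N) (g : RN N → ℝ) : ℝ :=
  ∫ y, m ^ N * profile (m ^ 2 * ‖y - x‖ ^ 2) * g y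

variable {N : ℕ} {g : RN N → ℝ}

theorem continuous_comp_normSq {f : ℝ → ℝ} (hf : Continuous f) (m : ℝ) (x : RN N) :
    Continuous (fun y : RN N => f (m ^ 2 * ‖y - x‖ ^ 2)) := by
  fun_prop

theorem integrable_comp_normSq_mul {f : ℝ → ℝ} (hf : Continuous f)
    (h0 : ∀ r, 1 ≤ r → f r = 0) (hg : LocallyIntegrable g volume) {m : ℝ} (hm : 0 < m)
    (x : RN N) : Integrable (fun y => f (m ^ 2 * ‖y - x‖ ^ 2) * g y) := by
  have := hg.integrable_smul_left_of_hasCompactSupport (continuous_comp_normSq hf m x)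
    (hasCompactSupport_comp_normSq h0 hm x)
  simpa using this

theorem integrable_kernel_mul (hg : LocallyIntegrable g volume) {m : ℝ} (hm : 0 < m)
    (x : RN N) : Integrable (fun y => m ^ N * profile (m ^ 2 * ‖y - x‖ ^ 2) * g y) := by
  simpa [mul_assoc] using
    (integrable_comp_normSq_mul contDiff_profile.continuous (fun _ => profile_eq_zero)
      hg hm x).const_mul (m ^ N)

theorem IsSuperharmonic.integral_profileDeriv_nonneg (hs : IsSuperharmonic g) {m : ℝ}
    (hm : 0 < m) (x : RN N) :
    0 ≤ ∫ y, profileDeriv N (m ^ 2 * ‖y - x‖ ^ 2) * g y := by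
  have h := hs _ (contDiff_potential m x)
    (hasCompactSupport_comp_normSq (f := fun r => expNegInvGlue (1 - r))
      (fun r hr => expNegInvGlue.zero_of_nonpos (by linarith)) hm x)
    (fun _ => expNegInvGlue.nonneg _)
  have h2 : ∫ y, g y * Δ (fun z : RN N => expNegInvGlue (1 - m ^ 2 * ‖z - x‖ ^ 2)) y =
      -(2 * m ^ 2) * ∫ y, profileDeriv N (m ^ 2 * ‖y - x‖ ^ 2) * g y := by
    rw [← integral_const_mul]
    refine integral_congr_ae (Eventually.of_forall fun y => ?_)
    simp only [laplacian_potential]; ring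
  rw [h2] at h
  by_contra hneg
  push Not at hneg
  have : 0 < m ^ 2 := by positivity
  nlinarith

theorem hasDerivAt_kernelMean (hN : N ≠ 0) (hg : LocallyIntegrable g volume) {m : ℝ} (hm : 0 < m)
    (x : RN N) : HasDerivAt (fun m => kernelMean m x g)
      (∫ y, m ^ (N - 1) * profileDeriv N (m ^ 2 * ‖y - x‖ ^ 2) * g y) m := by
  obtain ⟨C, hC, hbd⟩ := exists_bound_of_eq_zero_of_one_le (continuous_profileDeriv N)
    (fun r => profileDeriv_eq_zero N (r := r))
  -- For t in this interval all kernels are supported in the ball of radius 1/(m/2) and t^(N-1) ≤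
  -- (2m)^(N-1), which yields an integrable dominating function.
  have hs : Ioo (m / 2) (2 * m) ∈ 𝓝 m := Ioo_mem_nhds (by linarith) (by linarith)
  refine (hasDerivAt_integral_of_dominated_loc_of_deriv_le
    (bound := (Metric.closedBall x (1 / (m / 2))).indicator
      fun y => (2 * m) ^ (N - 1) * C * ‖g y‖)
    (F' := fun m y => m ^ (N - 1) * profileDeriv N (m ^ 2 * ‖y - x‖ ^ 2) * g y)
    hs ?_ (integrable_kernel_mul hg hm x) ?_ ?_ ?_ ?_).2
  · filter_upwards [hs] with t ht
    exact (integrable_kernel_mul hg (by linarith [ht.1]) x).aestronglyMeasurable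
  · have := (integrable_comp_normSq_mul (continuous_profileDeriv N)
      (fun _ => profileDeriv_eq_zero N) hg hm x).const_mul (m ^ (N - 1))
    simpa [mul_assoc] using this.aestronglyMeasurable
  · refine Eventually.of_forall fun y t ht => ?_
    have ht0 : 0 < t := by linarith [ht.1]
    by_cases hy : y ∈ Metric.closedBall x (1 / (m / 2))
    · rw [indicator_of_mem hy, norm_mul, norm_mul]
      have h1 : ‖t ^ (N - 1)‖ ≤ (2 * m) ^ (N - 1) := by
        rw [norm_pow, Real.norm_of_nonneg ht0.le]
        exact pow_le_pow_left₀ ht0.le ht.2.le _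
      have h2 := hbd (t ^ 2 * ‖y - x‖ ^ 2) (by positivity)
      rw [← Real.norm_eq_abs] at h2
      gcongr
    · rw [indicator_of_notMem hy]
      have h2 : y ∉ Metric.closedBall x (1 / t) := fun h =>
        hy (Metric.closedBall_subset_closedBall
          (one_div_le_one_div_of_le (by linarith) ht.1.le) h)
      rw [profileDeriv_eq_zero N ((notMem_closedBall_iff_one_lt ht0 x y).1 h2).le]
      simp
  · rw [integrable_indicator_iff Metric.isClosed_closedBall.measurableSet]
    exact ((hg.integrableOn_isCompact (isCompact_closedBall _ _)).norm).const_mul _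
  · refine Eventually.of_forall fun y t _ => ?_
    exact (hasDerivAt_kernel hN _ _).mul_const _

/-- Here m is the inverse radius: means of a superharmonic function grow as the ball shrinks. -/
theorem IsSuperharmonic.monotoneOn_kernelMean (hN : N ≠ 0) (hs : IsSuperharmonic g)
    (hg : LocallyIntegrable g volume) (x : RN N) :
    MonotoneOn (fun m => kernelMean m x g) (Ioi 0) := by
  refine monotoneOn_of_deriv_nonneg (convex_Ioi 0)
    (fun m hm => (hasDerivAt_kernelMean hN hg hm x).continuousAt.continuousWithinAt)
    (fun m hm => ?_) (fun m hm => ?_) <;> rw [interior_Ioi] at hm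
  · exact (hasDerivAt_kernelMean hN hg hm x).differentiableAt.differentiableWithinAt
  · rw [(hasDerivAt_kernelMean hN hg hm x).deriv]
    simp only [mul_assoc, integral_const_mul]
    exact mul_nonneg (pow_nonneg (le_of_lt hm) _) (hs.integral_profileDeriv_nonneg hm x)

/-- The kernels at scale `1 / m` are bounded by `C m^N` times the indicator of the ball. -/
theorem exists_norm_kernelMean_le (N : ℕ) : ∃ C, 0 < C ∧ ∀ (g : RN N → ℝ),
    LocallyIntegrable g volume → ∀ m, 0 < m → ∀ x,
      |kernelMean m x g| ≤ C * m ^ N * ∫ y in Metric.closedBall x (1 / m), ‖g y‖ := by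
  obtain ⟨C, hC, hbd⟩ := exists_bound_of_eq_zero_of_one_le contDiff_profile.continuous
    (fun r => profile_eq_zero (r := r))
  refine ⟨C, hC, fun g hg m hm x => ?_⟩
  rw [← integral_const_mul, ← integral_indicator Metric.isClosed_closedBall.measurableSet,
    ← Real.norm_eq_abs]
  refine norm_integral_le_of_norm_le ?_ (Eventually.of_forall fun y => ?_)
  · rw [integrable_indicator_iff Metric.isClosed_closedBall.measurableSet]
    exact ((hg.integrableOn_isCompact (isCompact_closedBall _ _)).norm).const_mul _
  · by_cases hy : y ∈ Metric.closedBall x (1 / m)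
    · rw [indicator_of_mem hy, norm_mul, norm_mul]
      have h1 := hbd (m ^ 2 * ‖y - x‖ ^ 2) (by positivity)
      rw [← Real.norm_eq_abs] at h1
      rw [norm_pow, Real.norm_of_nonneg hm.le, mul_comm C]
      gcongr
    · rw [indicator_of_notMem hy,
        profile_eq_zero ((notMem_closedBall_iff_one_lt hm x y).1 hy).le]
      simp

theorem volume_real_closedBall (x : RN N) {m : ℝ} (hm : 0 < m) :
    (volume (Metric.closedBall x (1 / m))).toReal =
      (m ^ N)⁻¹ * (volume (Metric.ball (0 : RN N) 1)).toReal := by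
  rw [Measure.addHaar_closedBall _ _ (by positivity), ENNReal.toReal_mul,
    ENNReal.toReal_ofReal (by positivity)]
  simp

/-- Hölder on the ball of radius 1/m bounds the mean by a constant times m^N · m^{-N(1-1/p)} =
m^{N/p}, which tends to 0 with m because p is finite. -/
theorem tendsto_kernelMean_zero (hN : N ≠ 0) {p : ENNReal} (hp1 : 1 ≤ p) (hp : p ≠ ⊤)
    (hg : MemLp g p volume) (x : RN N) :
    Tendsto (fun m => kernelMean m x g) (𝓝[>] 0) (𝓝 0) := by
  obtain ⟨C, hC, hbd⟩ := exists_norm_kernelMean_le N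
  have hloc := hg.locallyIntegrable hp1
  have hp0 : 0 < p.toReal := ENNReal.toReal_pos (by positivity) hp
  set D := (volume (Metric.ball (0 : RN N) 1)).toReal
  set A := (eLpNorm g p volume).toReal
  have key : ∀ m, 0 < m → |kernelMean m x g| ≤
      C * A * D ^ (1 - 1 / p.toReal) * m ^ ((N : ℝ) / p.toReal) := by
    intro m hm
    refine (hbd g hloc m hm x).trans ?_
    have h1 : ∫ y in Metric.closedBall x (1 / m), ‖g y‖ ≤
        A * ((m ^ N)⁻¹ * D) ^ (1 - 1 / p.toReal) := by
      have hint := hloc.integrableOn_isCompact (isCompact_closedBall x (1 / m))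
      have h2 := eLpNorm_le_eLpNorm_mul_rpow_measure_univ
        (μ := volume.restrict (Metric.closedBall x (1 / m))) hp1
        hint.aestronglyMeasurable
      have h3 : eLpNorm g p (volume.restrict (Metric.closedBall x (1 / m))) ≤
          eLpNorm g p volume := eLpNorm_mono_measure _ Measure.restrict_le_self
      have hvol : volume (Metric.closedBall x (1 / m)) ≠ ⊤ := measure_closedBall_lt_top.ne
      have hexp : 0 ≤ 1 - 1 / p.toReal := by
        rw [sub_nonneg, div_le_one hp0]
        simpa using ENNReal.toReal_mono hp hp1
      rw [eLpNorm_one_eq_lintegral_enorm, Measure.restrict_apply_univ] at h2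
      have h4 := h2.trans (mul_le_mul_left h3 _)
      have h5 := ENNReal.toReal_mono (ENNReal.mul_ne_top hg.2.ne
        (ENNReal.rpow_ne_top_of_nonneg (by simpa using hexp) hvol)) h4
      rw [← integral_norm_eq_lintegral_enorm hint.aestronglyMeasurable, ENNReal.toReal_mul,
        ← ENNReal.toReal_rpow, volume_real_closedBall x hm] at h5
      simpa using h5
    have hD : 0 ≤ D := ENNReal.toReal_nonneg
    calc C * m ^ N * ∫ y in Metric.closedBall x (1 / m), ‖g y‖
        ≤ C * m ^ N * (A * ((m ^ N)⁻¹ * D) ^ (1 - 1 / p.toReal)) := by gcongr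
      _ = C * A * D ^ (1 - 1 / p.toReal) * m ^ ((N : ℝ) / p.toReal) := by
          rw [Real.mul_rpow (by positivity) hD, ← Real.rpow_natCast, ← Real.rpow_neg hm.le,
            ← Real.rpow_mul hm.le]
          have : m ^ ((N : ℝ) / p.toReal) =
              m ^ (N : ℝ) * m ^ (-(N : ℝ) * (1 - 1 / p.toReal)) := by
            rw [← Real.rpow_add hm]; congr 1; ring
          rw [this]; ring
  have hlim : Tendsto (fun m : ℝ => C * A * D ^ (1 - 1 / p.toReal) * m ^ ((N : ℝ) / p.toReal))
      (𝓝[>] 0) (𝓝 0) := by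
    have hNp : 0 < (N : ℝ) / p.toReal := by positivity
    have h : ContinuousAt (fun m : ℝ => m ^ ((N : ℝ) / p.toReal)) 0 :=
      Real.continuousAt_rpow_const _ _ (Or.inr hNp.le)
    have h' := (h.tendsto.mono_left (nhdsWithin_le_nhds (s := Ioi 0))).const_mul
      (C * A * D ^ (1 - 1 / p.toReal))
    simpa [Real.zero_rpow hNp.ne'] using h'
  refine squeeze_zero_norm' ?_ hlim
  filter_upwards [self_mem_nhdsWithin] with m hm using key m hm

/-- The total mass of the kernels. -/
noncomputable def kernelMass (N : ℕ) : ℝ := ∫ y : RN N, profile (‖y‖ ^ 2)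

theorem kernelMass_pos (N : ℕ) : 0 < kernelMass N := by
  have hc : Continuous (fun y : RN N => profile (‖y‖ ^ 2)) :=
    contDiff_profile.continuous.comp (by fun_prop)
  have hcs : HasCompactSupport (fun y : RN N => profile (‖y‖ ^ 2)) := by
    simpa using hasCompactSupport_comp_normSq (fun _ => profile_eq_zero) one_pos (0 : RN N)
  exact hc.integral_pos_of_hasCompactSupport_nonneg_nonzero hcs (fun _ => profile_nonneg _)
    (x := 0) (by simpa using (profile_pos zero_lt_one).ne')

/-- The factor m^N in the kernel compensates the dilation, so the total mass does not depend on the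
scale. -/
theorem kernelMean_const {m : ℝ} (hm : 0 < m) (x : RN N) (c : ℝ) :
    kernelMean m x (fun _ => c) = kernelMass N * c := by
  unfold kernelMean kernelMass
  rw [integral_mul_const, integral_const_mul]
  congr 1
  have h1 := integral_sub_right_eq_self (μ := (volume : Measure (RN N)))
    (fun y => profile (m ^ 2 * ‖y‖ ^ 2)) x
  have h2 := Measure.integral_comp_smul (volume : Measure (RN N))
    (fun y => profile (‖y‖ ^ 2)) m
  simp only [norm_smul, mul_pow, Real.norm_eq_abs, sq_abs, smul_eq_mul] at h2
  rw [h1, h2, ← mul_assoc]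
  simp only [finrank_euclideanSpace, Fintype.card_fin]
  rw [abs_of_pos (by positivity), mul_inv_cancel₀ (by positivity), one_mul]

/-- After subtracting the constant g(x), the kernel is dominated by a multiple of the normalised
indicator of the ball. The hypothesis covers both Lebesgue points and points of continuity. -/
theorem tendsto_kernelMean_of_tendsto_average (hg : LocallyIntegrable g volume) {x : RN N}
    (h : Tendsto (fun m : ℝ => ⨍ y in Metric.closedBall x (1 / m), ‖g y - g x‖) atTop (𝓝 0)) :
    Tendsto (fun m => kernelMean m x g) atTop (𝓝 (kernelMass N * g x)) := by
  obtain ⟨C, hC, hbd⟩ := exists_norm_kernelMean_le N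
  have hloc : LocallyIntegrable (fun y => g y - g x) volume :=
    hg.sub (locallyIntegrable_const _)
  set D := (volume (Metric.ball (0 : RN N) 1)).toReal
  have hD : 0 < D := ENNReal.toReal_pos
    (Metric.measure_ball_pos _ _ one_pos).ne' measure_ball_lt_top.ne
  rw [tendsto_iff_norm_sub_tendsto_zero]
  refine squeeze_zero' (Eventually.of_forall fun _ => norm_nonneg _) ?_
    (by simpa only [mul_zero] using h.const_mul (C * D))
  filter_upwards [eventually_gt_atTop 0] with m hm
  have hsub : kernelMean m x g - kernelMass N * g x = kernelMean m x (fun y => g y - g x) := by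
    rw [← kernelMean_const hm x (g x)]
    unfold kernelMean
    rw [← integral_sub (integrable_kernel_mul hg hm x)
      (integrable_kernel_mul (locallyIntegrable_const _) hm x)]
    simp only [mul_sub]
  rw [hsub, Real.norm_eq_abs]
  refine (hbd _ hloc m hm x).trans (le_of_eq ?_)
  rw [setAverage_eq, measureReal_def, volume_real_closedBall x hm, smul_eq_mul, mul_inv, inv_inv]
  field_simp
  exact (mul_div_cancel_right₀ _ hD.ne').symm

theorem ae_tendsto_kernelMean (hg : LocallyIntegrable g volume) :
    ∀ᵐ x, Tendsto (fun m => kernelMean m x g) atTop (𝓝 (kernelMass N * g x)) := by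
  filter_upwards [IsUnifLocDoublingMeasure.ae_tendsto_average_norm_sub volume hg 1] with x hx
  refine tendsto_kernelMean_of_tendsto_average hg (hx (fun _ => x) (fun m => 1 / m) ?_ ?_)
  · simpa using tendsto_inv_atTop_nhdsGT_zero
  · filter_upwards [eventually_gt_atTop 0] with m hm
    exact Metric.mem_closedBall_self (by positivity)

theorem tendsto_kernelMean_of_continuous (hg : Continuous g) (x : RN N) :
    Tendsto (fun m => kernelMean m x g) atTop (𝓝 (kernelMass N * g x)) := by
  refine tendsto_kernelMean_of_tendsto_average hg.locallyIntegrable ?_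
  rw [Metric.tendsto_atTop]
  intro ε hε
  obtain ⟨δ, hδ, hcont⟩ := Metric.continuousAt_iff.1 (hg.continuousAt (x := x)) (ε / 2) (by positivity)
  refine ⟨2 / δ, fun m hm => ?_⟩
  have hm0 : 0 < m := lt_of_lt_of_le (by positivity) hm
  have hlt : 1 / m < δ := by
    rw [div_lt_iff₀ hm0]
    rw [ge_iff_le, div_le_iff₀ hδ] at hm
    linarith
  have hV : volume (Metric.closedBall x (1 / m)) ≠ 0 :=
    (Metric.measure_closedBall_pos _ _ (by positivity)).ne'
  have hV' : volume (Metric.closedBall x (1 / m)) ≠ ⊤ := measure_closedBall_lt_top.ne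
  have hint : IntegrableOn (fun y => ‖g y - g x‖) (Metric.closedBall x (1 / m)) :=
    (hg.sub continuous_const).norm.continuousOn.integrableOn_compact (isCompact_closedBall _ _)
  have h1 : ⨍ y in Metric.closedBall x (1 / m), ‖g y - g x‖ ≤ ε / 2 := by
    rw [setAverage_eq, measureReal_def, smul_eq_mul, inv_mul_le_iff₀ (ENNReal.toReal_pos hV hV')]
    have := setIntegral_mono_on hint (integrableOn_const hV' (C := ε / 2))
      Metric.isClosed_closedBall.measurableSet (fun y hy => by
        have := hcont (lt_of_le_of_lt hy hlt)
        rw [dist_eq_norm] at this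
        exact this.le)
    simpa [measureReal_def] using this
  have h0 : 0 ≤ ⨍ y in Metric.closedBall x (1 / m), ‖g y - g x‖ := by
    rw [setAverage_eq]
    exact smul_nonneg (by positivity) (integral_nonneg fun _ => norm_nonneg _)
  rw [Real.dist_eq, sub_zero, abs_of_nonneg h0]
  linarith

/-- The mean is increasing in m and starts from the limit 0 at m = 0. -/
theorem IsSuperharmonic.kernelMean_nonneg (hN : N ≠ 0) (hs : IsSuperharmonic g) {p : ENNReal}
    (hp1 : 1 ≤ p) (hp : p ≠ ⊤) (hg : MemLp g p volume) {m : ℝ} (hm : 0 < m) (x : RN N) :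
    0 ≤ kernelMean m x g := by
  refine le_of_tendsto (tendsto_kernelMean_zero hN hp1 hp hg x) ?_
  filter_upwards [self_mem_nhdsWithin, mem_nhdsWithin_of_mem_nhds (Iio_mem_nhds hm)] with t ht htm
  exact hs.monotoneOn_kernelMean hN (hg.locallyIntegrable hp1) x ht hm (le_of_lt htm)

/-- A superharmonic function in `L^p`, `1 ≤ p < ∞`, is nonnegative. -/
theorem IsSuperharmonic.ae_nonneg (hN : N ≠ 0) (hs : IsSuperharmonic g) {p : ENNReal}
    (hp1 : 1 ≤ p) (hp : p ≠ ⊤) (hg : MemLp g p volume) : ∀ᵐ x, 0 ≤ g x := by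
  filter_upwards [ae_tendsto_kernelMean (hg.locallyIntegrable hp1)] with x hx
  have : 0 ≤ kernelMass N * g x := ge_of_tendsto hx (by
    filter_upwards [eventually_gt_atTop 0] with m hm using hs.kernelMean_nonneg hN hp1 hp hg hm x)
  exact nonneg_of_mul_nonneg_right this (kernelMass_pos N)

/-- If the mean vanishes for one radius, monotonicity and nonnegativity make it vanish for all
larger radii. The profile is positive inside the ball, so g would vanish on every ball around x. -/
theorem IsSuperharmonic.kernelMean_pos (hN : N ≠ 0) (hs : IsSuperharmonic g) {p : ENNReal}
    (hp1 : 1 ≤ p) (hp : p ≠ ⊤) (hg : MemLp g p volume) (hne : ¬ g =ᵐ[volume] 0) {m : ℝ}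
    (hm : 0 < m) (x : RN N) : 0 < kernelMean m x g := by
  have hloc := hg.locallyIntegrable hp1
  have hnn := hs.ae_nonneg hN hp1 hp hg
  refine (hs.kernelMean_nonneg hN hp1 hp hg hm x).lt_of_ne' fun h0 => hne ?_
  have hball : ∀ n : ℕ, ∀ᵐ y, y ∈ Metric.ball x (n : ℝ) → g y = 0 := by
    intro n
    -- The bound t ≤ 1/(n+1) places the ball of radius n strictly inside the support of the kernel,
    -- and t ≤ m allows the comparison with the vanishing mean.
    set t : ℝ := min m (1 / (n + 1)) with ht
    have ht0 : 0 < t := by positivity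
    have hle := hs.monotoneOn_kernelMean hN hloc x ht0 hm (min_le_left _ _)
    have heq : kernelMean t x g = 0 :=
      le_antisymm (hle.trans h0.le) (hs.kernelMean_nonneg hN hp1 hp hg ht0 x)
    have hz := (integral_eq_zero_iff_of_nonneg_ae (by
      filter_upwards [hnn] with y hy
      exact mul_nonneg (mul_nonneg (by positivity) (profile_nonneg _)) hy)
      (integrable_kernel_mul hloc ht0 x)).1 heq
    filter_upwards [hz] with y hy hyb
    have hlt : t ^ 2 * ‖y - x‖ ^ 2 < 1 := by
      rw [Metric.mem_ball, dist_eq_norm] at hyb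
      rw [← mul_pow, sq_lt_one_iff₀ (by positivity)]
      calc t * ‖y - x‖ ≤ 1 / (n + 1) * ‖y - x‖ := by gcongr; exact min_le_right _ _
        _ < 1 / (n + 1) * (n + 1) := by gcongr; linarith
        _ = 1 := by field_simp
    have hk : t ^ N * profile (t ^ 2 * ‖y - x‖ ^ 2) ≠ 0 :=
      (mul_pos (by positivity) (profile_pos hlt)).ne'
    simpa [hk] using (mul_eq_zero.1 hy).resolve_left hk
  filter_upwards [ae_all_iff.2 hball] with y hy
  obtain ⟨n, hn⟩ := exists_nat_gt (dist y x)
  exact hy n hn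

theorem kernelMean_congr {g' : RN N → ℝ} (h : g =ᵐ[volume] g') (m : ℝ) (x : RN N) :
    kernelMean m x g = kernelMean m x g' :=
  integral_congr_ae (by filter_upwards [h] with y hy; rw [hy])

/-- The limit dominates the mean at scale 1, which is positive. Leaving the value c free serves both
the almost everywhere statement, with c = g x, and the pointwise one for a continuous
representative. -/
theorem IsSuperharmonic.pos_of_tendsto (hN : N ≠ 0) (hs : IsSuperharmonic g) {p : ENNReal}
    (hp1 : 1 ≤ p) (hp : p ≠ ⊤) (hg : MemLp g p volume) (hne : ¬ g =ᵐ[volume] 0) {x : RN N} {c : ℝ}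
    (hc : Tendsto (fun m => kernelMean m x g) atTop (𝓝 (kernelMass N * c))) : 0 < c := by
  have h : kernelMean 1 x g ≤ kernelMass N * c := ge_of_tendsto hc (by
    filter_upwards [eventually_ge_atTop 1] with m hm
    exact hs.monotoneOn_kernelMean hN (hg.locallyIntegrable hp1) x
      (mem_Ioi.2 one_pos) (mem_Ioi.2 (by linarith)) hm)
  exact pos_of_mul_pos_right ((hs.kernelMean_pos hN hp1 hp hg hne one_pos x).trans_le h)
    (kernelMass_pos N).le

/-- Strong minimum principle: a superharmonic function in `L^p` that does not vanish is positive
almost everywhere, and its continuous representatives are positive everywhere. -/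
theorem IsSuperharmonic.ae_pos (hN : N ≠ 0) (hs : IsSuperharmonic g) {p : ENNReal}
    (hp1 : 1 ≤ p) (hp : p ≠ ⊤) (hg : MemLp g p volume) (hne : ¬ g =ᵐ[volume] 0) :
    (∀ᵐ x, 0 < g x) ∧ ∀ w : RN N → ℝ, Continuous w → w =ᵐ[volume] g → ∀ x, 0 < w x := by
  refine ⟨?_, fun w hw hwg x => ?_⟩
  · filter_upwards [ae_tendsto_kernelMean (hg.locallyIntegrable hp1)] with x hx
    exact hs.pos_of_tendsto hN hp1 hp hg hne hx
  · have := tendsto_kernelMean_of_continuous hw x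
    simp only [kernelMean_congr hwg] at this
    exact hs.pos_of_tendsto hN hp1 hp hg hne this

end BiharmonicCritical

namespace BiharmonicCritical

variable {N : ℕ}

/-! ### The Sobolev inequality for test functions -/

theorem integral_mul_partialDeriv {f g : RN N → ℝ} (hf : ContDiff ℝ ∞ f)
    (hfc : HasCompactSupport f) (hg : ContDiff ℝ ∞ g) (i : Fin N) :
    ∫ x, f x * partialDeriv i g x = -∫ x, partialDeriv i f x * g x :=
  integral_mul_fderiv_eq_neg_fderiv_mul_of_integrable
    (((contDiff_partialDeriv hf i).continuous.mul hg.continuous).integrable_of_hasCompactSupport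
      (hasCompactSupport_partialDeriv hfc i).mul_right)
    ((hf.continuous.mul (contDiff_partialDeriv hg i).continuous).integrable_of_hasCompactSupport
      hfc.mul_right)
    ((hf.continuous.mul hg.continuous).integrable_of_hasCompactSupport hfc.mul_right)
    (fun x _ => hf.differentiable (by simp) x) (fun x _ => hg.differentiable (by simp) x)

theorem partialDeriv_comm {f : RN N → ℝ} (hf : ContDiff ℝ ∞ f) (i j : Fin N) :
    partialDeriv i (partialDeriv j f) = partialDeriv j (partialDeriv i f) := by
  funext x
  have h : DifferentiableAt ℝ (fderiv ℝ f) x :=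
    ((hf.fderiv_right (m := ∞) (by simp)).differentiable (by simp)).differentiableAt
  have hs : IsSymmSndFDerivAt ℝ f x :=
    hf.contDiffAt.isSymmSndFDerivAt (by
      simp only [minSmoothness_of_isRCLikeNormedField]; exact WithTop.coe_le_coe.2 le_top)
  unfold partialDeriv
  rw [fderiv_clm_apply h (differentiableAt_const _), fderiv_clm_apply h (differentiableAt_const _)]
  simpa using hs (stdBasis N i) (stdBasis N j)

/-- Two integrations by parts and the symmetry of second derivatives. Summed over i and j, this says
that the full Hessian and the Laplacian have the same L² norm. -/
theorem integral_mul_partialDeriv_partialDeriv {f : RN N → ℝ} (hf : ContDiff ℝ ∞ f)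
    (hfc : HasCompactSupport f) (i j : Fin N) :
    ∫ x, partialDeriv i (partialDeriv i f) x * partialDeriv j (partialDeriv j f) x =
      ∫ x, (partialDeriv j (partialDeriv i f) x) ^ 2 := by
  have hi := contDiff_partialDeriv hf i
  have hj := contDiff_partialDeriv hf j
  rw [integral_mul_partialDeriv (contDiff_partialDeriv hi i)
    (hasCompactSupport_partialDeriv (hasCompactSupport_partialDeriv hfc i) i) hj j,
    partialDeriv_comm hi j i]
  have := integral_mul_partialDeriv hj (hasCompactSupport_partialDeriv hfc j)
    (contDiff_partialDeriv hi j) i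
  simp only [mul_comm (partialDeriv j f _)] at this
  rw [this, neg_neg, partialDeriv_comm hf i j]
  simp only [sq]

theorem integral_laplacian_sq {f : RN N → ℝ} (hf : ContDiff ℝ ∞ f) (hfc : HasCompactSupport f) :
    ∫ x, (Δ f x) ^ 2 = ∑ i, ∑ j, ∫ x, (partialDeriv j (partialDeriv i f) x) ^ 2 := by
  rw [laplacian_eq_sum_partialDeriv hf]
  simp only [sq, Finset.sum_mul_sum]
  have hint : ∀ i j, Integrable fun x =>
      partialDeriv i (partialDeriv i f) x * partialDeriv j (partialDeriv j f) x := fun i j =>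
    ((contDiff_partialDeriv (contDiff_partialDeriv hf i) i).continuous.mul
      (contDiff_partialDeriv (contDiff_partialDeriv hf j) j).continuous
      ).integrable_of_hasCompactSupport
      (hasCompactSupport_partialDeriv (hasCompactSupport_partialDeriv hfc i) i).mul_right
  rw [integral_finsetSum _ fun i _ => integrable_finsetSum _ fun j _ => hint i j]
  refine Finset.sum_congr rfl fun i _ => ?_
  rw [integral_finsetSum _ fun j _ => hint i j]
  refine Finset.sum_congr rfl fun j _ => ?_
  rw [integral_mul_partialDeriv_partialDeriv hf hfc i j]
  simp only [sq]

theorem eLpNorm_two_eq_ofReal {α : Type*} [MeasurableSpace α] {μ : Measure α} {f : α → ℝ}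
    (hf : MemLp f 2 μ) : eLpNorm f 2 μ = ENNReal.ofReal (Real.sqrt (∫ x, (f x) ^ 2 ∂μ)) := by
  rw [hf.eLpNorm_eq_integral_rpow_norm (by simp) (by simp)]
  simp [Real.sqrt_eq_rpow]

theorem memLp_of_hasCompactSupport {f : RN N → ℝ} (hf : ContDiff ℝ ∞ f)
    (hfc : HasCompactSupport f) (p : ENNReal) : MemLp f p volume :=
  hf.continuous.memLp_of_hasCompactSupport hfc

theorem eLpNorm_partialDeriv_partialDeriv_le {f : RN N → ℝ} (hf : ContDiff ℝ ∞ f)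
    (hfc : HasCompactSupport f) (i j : Fin N) :
    eLpNorm (partialDeriv j (partialDeriv i f)) 2 volume ≤ eLpNorm (Δ f) 2 volume := by
  rw [eLpNorm_two_eq_ofReal (memLp_of_hasCompactSupport
      (contDiff_partialDeriv (contDiff_partialDeriv hf i) j)
      (hasCompactSupport_partialDeriv (hasCompactSupport_partialDeriv hfc i) j) 2),
    eLpNorm_two_eq_ofReal (memLp_of_hasCompactSupport (contDiff_laplacian hf)
      (hasCompactSupport_laplacian hf hfc) 2), integral_laplacian_sq hf hfc]
  refine ENNReal.ofReal_le_ofReal (Real.sqrt_le_sqrt ?_)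
  have hnn : ∀ i j, 0 ≤ ∫ x, (partialDeriv j (partialDeriv i f) x) ^ 2 := fun i j =>
    integral_nonneg fun _ => sq_nonneg _
  exact (Finset.single_le_sum (f := fun j => ∫ x, (partialDeriv j (partialDeriv i f) x) ^ 2)
    (fun j _ => hnn i j) (Finset.mem_univ j)).trans
    (Finset.single_le_sum (f := fun i => ∑ j, ∫ x, (partialDeriv j (partialDeriv i f) x) ^ 2)
    (fun i _ => Finset.sum_nonneg fun j _ => hnn i j) (Finset.mem_univ i))

theorem norm_fderiv_le_sum (f : RN N → ℝ) (x : RN N) :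
    ‖fderiv ℝ f x‖ ≤ ∑ i, ‖partialDeriv i f x‖ := by
  refine ContinuousLinearMap.opNorm_le_bound _ (Finset.sum_nonneg fun _ _ => norm_nonneg _)
    fun v => ?_
  have hv : v = ∑ i, v i • stdBasis N i := by
    simpa using ((stdBasis N).sum_repr v).symm
  conv_lhs => rw [hv]
  rw [map_sum, Finset.sum_mul]
  refine (norm_sum_le _ _).trans (Finset.sum_le_sum fun i _ => ?_)
  rw [map_smul, norm_smul, mul_comm]
  exact mul_le_mul_of_nonneg_left (PiLp.norm_apply_le v i) (norm_nonneg _)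

theorem eLpNorm_fderiv_le_sum {f : RN N → ℝ} (hf : ContDiff ℝ ∞ f) {p : ENNReal} (hp : 1 ≤ p) :
    eLpNorm (fderiv ℝ f) p volume ≤ ∑ i, eLpNorm (partialDeriv i f) p volume := by
  have h1 : eLpNorm (fderiv ℝ f) p volume ≤
      eLpNorm (∑ i, fun x => ‖partialDeriv i f x‖) p volume := by
    refine eLpNorm_mono_real fun x => ?_
    simpa using norm_fderiv_le_sum f x
  refine h1.trans ((eLpNorm_sum_le (fun i _ => ?_) hp).trans (le_of_eq ?_))
  · exact (contDiff_partialDeriv hf i).continuous.norm.aestronglyMeasurable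
  · simp only [eLpNorm_norm]

/-- The critical exponent as an element of `[0, ∞]`. -/
noncomputable abbrev critExpENN (N : ℕ) : ENNReal := ENNReal.ofReal (critExp N)

theorem two_lt_critExp (hN : 5 ≤ N) : 2 < critExp N := by
  have h : (5 : ℝ) ≤ N := by exact_mod_cast hN
  rw [critExp, lt_div_iff₀ (by linarith)]
  linarith

/-- The first-order Sobolev inequality is used twice: from L² to L^r for the partial derivatives, r
= 2N/(N-2), and from L^r to the critical exponent for f, since 1/r - 1/N = (N-4)/(2N). The Hessian
is then absorbed into the Laplacian. -/
theorem exists_sobolev_testFunction (hN : 5 ≤ N) : ∃ C : NNReal, ∀ f : RN N → ℝ,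
    ContDiff ℝ ∞ f → HasCompactSupport f →
      eLpNorm f (critExpENN N) volume ≤ C * eLpNorm (Δ f) 2 volume := by
  have h5 : (5 : ℝ) ≤ N := by exact_mod_cast hN
  set r : NNReal := Real.toNNReal (2 * N / (N - 2)) with hr
  have hr0 : (r : ℝ) = 2 * N / (N - 2) := Real.coe_toNNReal _ (div_nonneg (by linarith) (by linarith))
  have hr1 : 1 ≤ r := by
    rw [← NNReal.coe_le_coe, hr0, NNReal.coe_one, le_div_iff₀ (by linarith)]
    linarith
  set q : NNReal := Real.toNNReal (critExp N) with hq
  have hq0 : (q : ℝ) = 2 * N / (N - 4) := Real.coe_toNNReal _ (by linarith [two_lt_critExp hN])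
  have hfin : Module.finrank ℝ (RN N) = N := by simp
  have hn1 : (N : ℝ) - 2 ≠ 0 := by linarith
  have hn2 : (N : ℝ) - 4 ≠ 0 := by linarith
  have hn3 : (N : ℝ) ≠ 0 := by linarith
  set C₁ := SNormLESNormFDerivOfEqConst ℝ (volume : Measure (RN N)) r
  set C₂ := SNormLESNormFDerivOfEqConst ℝ (volume : Measure (RN N)) (2 : NNReal)
  -- Each factor N counts the coordinates when the norm of a derivative is bounded by the sum of its
  -- partial derivatives.
  refine ⟨C₁ * (N * (C₂ * N)), fun f hf hfc => ?_⟩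
  have h1 : eLpNorm f q volume ≤ C₁ * eLpNorm (fderiv ℝ f) r volume :=
    eLpNorm_le_eLpNorm_fderiv_of_eq volume (hf.of_le (by simp)) hfc hr1 (by rw [hfin]; omega) (by
      rw [hfin, hq0, NNReal.coe_inv, hr0]; field_simp; ring)
  have h2 : ∀ i, eLpNorm (partialDeriv i f) r volume ≤ C₂ * N * eLpNorm (Δ f) 2 volume := by
    intro i
    have h := eLpNorm_le_eLpNorm_fderiv_of_eq volume (p := 2) (p' := r)
      ((contDiff_partialDeriv hf i).of_le (by simp))
      (hasCompactSupport_partialDeriv hfc i) one_le_two (by rw [hfin]; omega) (by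
      rw [hfin, hr0]; push_cast; field_simp)
    refine h.trans ?_
    rw [mul_assoc]
    gcongr
    refine (eLpNorm_fderiv_le_sum (contDiff_partialDeriv hf i) (by simp)).trans ?_
    refine (Finset.sum_le_sum fun j _ => eLpNorm_partialDeriv_partialDeriv_le hf hfc i j).trans ?_
    simp
  calc eLpNorm f q volume ≤ C₁ * eLpNorm (fderiv ℝ f) r volume := h1
    _ ≤ C₁ * ∑ i, eLpNorm (partialDeriv i f) r volume := by
        gcongr; exact eLpNorm_fderiv_le_sum hf (by exact_mod_cast hr1)
    _ ≤ C₁ * ∑ i : Fin N, C₂ * N * eLpNorm (Δ f) 2 volume := by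
        gcongr with i; exact h2 i
    _ = _ := by
        simp only [Finset.sum_const, Finset.card_univ, Fintype.card_fin, nsmul_eq_mul]
        push_cast; ring

end BiharmonicCritical

namespace BiharmonicCritical

variable {N : ℕ}

/-! ### Hölder's inequality for pairings -/

section Pairing

variable {α : Type*} [MeasurableSpace α] {μ : Measure α} {p q : ENNReal}

theorem integrable_mul_of_memLp [ENNReal.HolderConjugate p q] {f g : α → ℝ} (hf : MemLp f p μ)
    (hg : MemLp g q μ) : Integrable (fun x => f x * g x) μ :=
  hf.integrable_mul hg

theorem abs_integral_mul_le [ENNReal.HolderConjugate p q] {f g : α → ℝ} (hf : MemLp f p μ)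
    (hg : MemLp g q μ) :
    |∫ x, f x * g x ∂μ| ≤ (eLpNorm f p μ).toReal * (eLpNorm g q μ).toReal := by
  have h1 : eLpNorm (f • g) 1 μ ≤ eLpNorm f p μ * eLpNorm g q μ :=
    eLpNorm_smul_le_mul_eLpNorm hg.1 hf.1
  have hint : Integrable (f • g) μ := hf.integrable_mul hg
  rw [← ENNReal.toReal_mul, ← Real.norm_eq_abs]
  refine (norm_integral_le_integral_norm _).trans ?_
  rw [eLpNorm_one_eq_lintegral_enorm] at h1
  have h2 := ENNReal.toReal_mono (ENNReal.mul_ne_top hf.2.ne hg.2.ne) h1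
  rwa [← integral_norm_eq_lintegral_enorm hint.1] at h2

theorem tendsto_integral_mul [ENNReal.HolderConjugate p q] {f : ℕ → α → ℝ} {f₀ g : α → ℝ}
    (hf : ∀ n, MemLp (f n) p μ) (hf₀ : MemLp f₀ p μ) (hg : MemLp g q μ)
    (h : Tendsto (fun n => eLpNorm (f n - f₀) p μ) atTop (𝓝 0)) :
    Tendsto (fun n => ∫ x, f n x * g x ∂μ) atTop (𝓝 (∫ x, f₀ x * g x ∂μ)) := by
  rw [tendsto_iff_norm_sub_tendsto_zero]
  have h' : Tendsto (fun n => (eLpNorm (f n - f₀) p μ).toReal * (eLpNorm g q μ).toReal)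
      atTop (𝓝 0) := by
    simpa using ((ENNReal.tendsto_toReal ENNReal.zero_ne_top).comp h).mul_const
      (eLpNorm g q μ).toReal
  refine squeeze_zero (fun _ => norm_nonneg _) (fun n => ?_) h'
  have : ∫ x, f n x * g x ∂μ - ∫ x, f₀ x * g x ∂μ = ∫ x, (f n - f₀) x * g x ∂μ := by
    rw [← integral_sub (integrable_mul_of_memLp (hf n) hg) (integrable_mul_of_memLp hf₀ hg)]
    simp only [Pi.sub_apply, sub_mul]
  rw [this]
  exact abs_integral_mul_le ((hf n).sub hf₀) hg

end Pairing

/-- The dual exponent of `2^*` as an element of `[0, ∞]`. -/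
noncomputable abbrev critConjENN (N : ℕ) : ENNReal :=
  ENNReal.ofReal (Real.conjExponent (critExp N))

theorem holderConjugate_critExp (hN : 5 ≤ N) :
    (critExp N).HolderConjugate (Real.conjExponent (critExp N)) :=
  Real.HolderConjugate.conjExponent (by linarith [two_lt_critExp hN])

theorem holderConjugate_critExpENN (hN : 5 ≤ N) :
    ENNReal.HolderConjugate (critExpENN N) (critConjENN N) :=
  (holderConjugate_critExp hN).ennrealOfReal

theorem one_le_critExpENN (hN : 5 ≤ N) : 1 ≤ critExpENN N :=
  ENNReal.one_le_ofReal.2 (by linarith [two_lt_critExp hN])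

/-! ### The space `𝒟^{2,2}` -/

theorem integral_mul_laplacian {f g : RN N → ℝ} (hf : ContDiff ℝ ∞ f)
    (hfc : HasCompactSupport f) (hg : ContDiff ℝ ∞ g) (hgc : HasCompactSupport g) :
    ∫ x, f x * Δ g x = ∫ x, Δ f x * g x := by
  rw [laplacian_eq_sum_partialDeriv hf, laplacian_eq_sum_partialDeriv hg]
  simp only [Finset.mul_sum, Finset.sum_mul]
  rw [integral_finsetSum _ fun i _ => ?_, integral_finsetSum _ fun i _ => ?_]
  · refine Finset.sum_congr rfl fun i _ => ?_
    have h := integral_mul_partialDeriv (contDiff_partialDeriv hg i)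
      (hasCompactSupport_partialDeriv hgc i) hf i
    rw [integral_mul_partialDeriv hf hfc (contDiff_partialDeriv hg i) i,
      integral_congr_ae (Eventually.of_forall fun x => mul_comm _ _), h, neg_neg]
    have h2 := integral_mul_partialDeriv hg hgc (contDiff_partialDeriv hf i) i
    have h3 := integral_mul_partialDeriv (contDiff_partialDeriv hf i)
      (hasCompactSupport_partialDeriv hfc i) hg i
    simp only [mul_comm] at h2 h3 h ⊢
    linarith
  · exact ((contDiff_partialDeriv (contDiff_partialDeriv hf i) i).continuous.mul
      hg.continuous).integrable_of_hasCompactSupport hgc.mul_left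
  · exact (hf.continuous.mul (contDiff_partialDeriv (contDiff_partialDeriv hg i) i).continuous
      ).integrable_of_hasCompactSupport hfc.mul_right

theorem hasD22Laplacian_of_testFunction {φ : RN N → ℝ} (hφ : ContDiff ℝ ∞ φ)
    (hc : HasCompactSupport φ) : HasD22Laplacian φ (Δ φ) :=
  ⟨memLp_of_hasCompactSupport hφ hc _,
    memLp_of_hasCompactSupport (contDiff_laplacian hφ) (hasCompactSupport_laplacian hφ hc) _,
    fun _ => φ, fun _ => ⟨hφ, hc⟩, by simp, by simp⟩

theorem laplacian_add' {φ ψ : RN N → ℝ} (hφ : ContDiff ℝ ∞ φ) (hψ : ContDiff ℝ ∞ ψ) :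
    Δ (φ + ψ) = Δ φ + Δ ψ := by
  funext x
  exact (hφ.of_le (WithTop.coe_le_coe.2 le_top)).contDiffAt.laplacian_add
    (hψ.of_le (WithTop.coe_le_coe.2 le_top)).contDiffAt

theorem laplacian_smul' {φ : RN N → ℝ} (hφ : ContDiff ℝ ∞ φ) (c : ℝ) :
    Δ (c • φ) = c • Δ φ := by
  funext x
  exact InnerProductSpace.laplacian_smul c
    (hφ.of_le (WithTop.coe_le_coe.2 le_top)).contDiffAt

namespace HasD22Laplacian

variable {u g u' g' : RN N → ℝ}

theorem congr (h : HasD22Laplacian u g) (hu : u =ᵐ[volume] u') (hg : g =ᵐ[volume] g') :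
    HasD22Laplacian u' g' := by
  obtain ⟨h1, h2, φ, hφ, h3, h4⟩ := h
  refine ⟨(memLp_congr_ae hu).1 h1, (memLp_congr_ae hg).1 h2, φ, hφ, ?_, ?_⟩
  · exact h3.congr fun n => eLpNorm_congr_ae (EventuallyEq.rfl.sub hu)
  · exact h4.congr fun n => eLpNorm_congr_ae (EventuallyEq.rfl.sub hg)

theorem add (hN : 5 ≤ N) (h : HasD22Laplacian u g) (h' : HasD22Laplacian u' g') :
    HasD22Laplacian (u + u') (g + g') := by
  obtain ⟨h1, h2, φ, hφ, h3, h4⟩ := h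
  obtain ⟨h1', h2', φ', hφ', h3', h4'⟩ := h'
  refine ⟨h1.add h1', h2.add h2', fun n => φ n + φ' n,
    fun n => ⟨(hφ n).1.add (hφ' n).1, (hφ n).2.add (hφ' n).2⟩, ?_, ?_⟩
  · refine tendsto_of_tendsto_of_tendsto_of_le_of_le tendsto_const_nhds
      (by simpa using h3.add h3') (fun _ => zero_le) (fun n => ?_)
    rw [add_sub_add_comm]
    exact eLpNorm_add_le (((hφ n).1.continuous.aestronglyMeasurable).sub h1.1)
      (((hφ' n).1.continuous.aestronglyMeasurable).sub h1'.1) (one_le_critExpENN hN)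
  · refine tendsto_of_tendsto_of_tendsto_of_le_of_le tendsto_const_nhds
      (by simpa using h4.add h4') (fun _ => zero_le) (fun n => ?_)
    rw [laplacian_add' (hφ n).1 (hφ' n).1, add_sub_add_comm]
    exact eLpNorm_add_le
      (((contDiff_laplacian (hφ n).1).continuous.aestronglyMeasurable).sub h2.1)
      (((contDiff_laplacian (hφ' n).1).continuous.aestronglyMeasurable).sub h2'.1) (by simp)

theorem smul (h : HasD22Laplacian u g) (c : ℝ) : HasD22Laplacian (c • u) (c • g) := by
  obtain ⟨h1, h2, φ, hφ, h3, h4⟩ := h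
  refine ⟨h1.const_smul c, h2.const_smul c, fun n => c • φ n,
    fun n => ⟨contDiff_const.smul (hφ n).1, (hφ n).2.smul_left (f := fun _ => c)⟩, ?_, ?_⟩
  · have := ENNReal.Tendsto.const_mul h3 (Or.inr (enorm_ne_top (x := c)))
    simpa only [← smul_sub, eLpNorm_const_smul, mul_zero] using this
  · have := ENNReal.Tendsto.const_mul h4 (Or.inr (enorm_ne_top (x := c)))
    simp only [laplacian_smul' (hφ _).1, ← smul_sub, eLpNorm_const_smul]
    simpa only [mul_zero] using this

theorem sub (hN : 5 ≤ N) (h : HasD22Laplacian u g) (h' : HasD22Laplacian u' g') :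
    HasD22Laplacian (u - u') (g - g') := by
  simpa [sub_eq_add_neg] using h.add hN (h'.smul (-1))

theorem integral_mul_laplacian (hN : 5 ≤ N) (h : HasD22Laplacian u g) {ψ : RN N → ℝ}
    (hψ : ContDiff ℝ ∞ ψ) (hc : HasCompactSupport ψ) :
    ∫ x, u x * Δ ψ x = ∫ x, g x * ψ x := by
  obtain ⟨h1, h2, φ, hφ, h3, h4⟩ := h
  have := holderConjugate_critExpENN hN
  have hl : ∀ {f : RN N → ℝ}, ContDiff ℝ ∞ f → HasCompactSupport f → ∀ p, MemLp (Δ f) p volume :=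
    fun hf hfc p =>
      memLp_of_hasCompactSupport (contDiff_laplacian hf) (hasCompactSupport_laplacian hf hfc) p
  have t1 := tendsto_integral_mul (fun n => memLp_of_hasCompactSupport (hφ n).1 (hφ n).2 _) h1
    (hl hψ hc (critConjENN N)) h3
  have t2 := tendsto_integral_mul (fun n => hl (hφ n).1 (hφ n).2 2) h2
    (memLp_of_hasCompactSupport hψ hc 2) h4
  simp only [BiharmonicCritical.integral_mul_laplacian (hφ _).1 (hφ _).2 hψ hc] at t1
  exact tendsto_nhds_unique t1 t2

/-- Both functions are the distributional Laplacian of u. This makes the choice of representative in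
`lap` immaterial. -/
theorem unique (hN : 5 ≤ N) (h : HasD22Laplacian u g) (h' : HasD22Laplacian u g') :
    g =ᵐ[volume] g' := by
  have hd : MemLp (g - g') 2 volume := h.2.1.sub h'.2.1
  have := ae_eq_zero_of_integral_contDiff_smul_eq_zero (hd.locallyIntegrable (by simp))
    (fun ψ hψ hc => ?_)
  · filter_upwards [this] with x hx
    simpa [sub_eq_zero] using hx
  · have hz := (h.sub hN h').integral_mul_laplacian hN hψ hc
    simp only [sub_self, Pi.zero_apply, zero_mul, integral_zero] at hz
    rw [hz]
    exact integral_congr_ae (Eventually.of_forall fun x => by simp [mul_comm])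

end HasD22Laplacian

theorem exists_sobolev (hN : 5 ≤ N) : ∃ C : NNReal, ∀ u g : RN N → ℝ, HasD22Laplacian u g →
    eLpNorm u (critExpENN N) volume ≤ C * eLpNorm g 2 volume := by
  obtain ⟨C, hC⟩ := exists_sobolev_testFunction hN
  refine ⟨C, fun u g h => ?_⟩
  obtain ⟨h1, h2, φ, hφ, h3, h4⟩ := h
  have hle : ∀ n, eLpNorm u (critExpENN N) volume ≤
      eLpNorm (φ n - u) (critExpENN N) volume +
        C * (eLpNorm (Δ (φ n) - g) 2 volume + eLpNorm g 2 volume) := by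
    intro n
    have m1 := (hφ n).1.continuous.aestronglyMeasurable (μ := volume)
    have m2 := (contDiff_laplacian (hφ n).1).continuous.aestronglyMeasurable (μ := volume)
    calc eLpNorm u (critExpENN N) volume
        = eLpNorm ((u - φ n) + φ n) (critExpENN N) volume := by rw [sub_add_cancel]
      _ ≤ eLpNorm (u - φ n) (critExpENN N) volume + eLpNorm (φ n) (critExpENN N) volume :=
          eLpNorm_add_le (h1.1.sub m1) m1 (one_le_critExpENN hN)
      _ ≤ eLpNorm (φ n - u) (critExpENN N) volume + C * eLpNorm (Δ (φ n)) 2 volume := by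
          rw [eLpNorm_sub_comm]
          gcongr
          exact hC _ (hφ n).1 (hφ n).2
      _ ≤ _ := by
          gcongr
          calc eLpNorm (Δ (φ n)) 2 volume = eLpNorm ((Δ (φ n) - g) + g) 2 volume := by
                rw [sub_add_cancel]
            _ ≤ _ := eLpNorm_add_le (m2.sub h2.1) h2.1 (by simp)
  have hlim : Tendsto (fun n => eLpNorm (φ n - u) (critExpENN N) volume +
      C * (eLpNorm (Δ (φ n) - g) 2 volume + eLpNorm g 2 volume)) atTop
      (𝓝 (0 + C * (0 + eLpNorm g 2 volume))) :=
    h3.add (ENNReal.Tendsto.const_mul (h4.add_const _) (Or.inr ENNReal.coe_ne_top))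
  simpa using ge_of_tendsto' hlim hle

theorem HasD22Laplacian.eq_of_laplacian_eq (hN : 5 ≤ N) {u u' g : RN N → ℝ}
    (h : HasD22Laplacian u g) (h' : HasD22Laplacian u' g) : u =ᵐ[volume] u' := by
  obtain ⟨C, hC⟩ := exists_sobolev hN
  have hd := h.sub hN h'
  have := hC _ _ hd
  simp only [sub_self, eLpNorm_zero, mul_zero, nonpos_iff_eq_zero] at this
  have hp : critExpENN N ≠ 0 := (zero_lt_one.trans_le (one_le_critExpENN hN)).ne'
  have h0 := (eLpNorm_eq_zero_iff hd.1.1 hp).1 this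
  filter_upwards [h0] with x hx
  simpa [sub_eq_zero] using hx

end BiharmonicCritical

namespace BiharmonicCritical

variable {N : ℕ}

/-! ### The equation `Δ² w = f` -/

/-- The `L²` closure of the Laplacians of test functions consists of Laplacians of elements of
`𝒟^{2,2}`. -/
theorem exists_hasD22Laplacian_of_tendsto (hN : 5 ≤ N) {φ : ℕ → RN N → ℝ}
    (hφ : ∀ n, ContDiff ℝ ∞ (φ n) ∧ HasCompactSupport (φ n)) {g : RN N → ℝ}
    (hg : MemLp g 2 volume)
    (h : Tendsto (fun n => eLpNorm (Δ (φ n) - g) 2 volume) atTop (𝓝 0)) :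
    ∃ u, HasD22Laplacian u g := by
  obtain ⟨C, hC⟩ := exists_sobolev hN
  have : Fact (1 ≤ critExpENN N) := ⟨one_le_critExpENN hN⟩
  have hφL := fun n => hasD22Laplacian_of_testFunction (hφ n).1 (hφ n).2
  set F : ℕ → Lp ℝ (critExpENN N) (volume : Measure (RN N)) := fun n => (hφL n).1.toLp
  set G : ℕ → Lp ℝ 2 (volume : Measure (RN N)) := fun n => (hφL n).2.1.toLp
  have hG : Tendsto G atTop (𝓝 hg.toLp) := by
    rw [Lp.tendsto_Lp_iff_tendsto_eLpNorm'']
    exact h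
  have hF : CauchySeq F := by
    rw [Metric.cauchySeq_iff']
    intro ε hε
    obtain ⟨n₀, hn₀⟩ := Metric.cauchySeq_iff'.1 hG.cauchySeq (ε / (C + 1)) (by positivity)
    refine ⟨n₀, fun n hn => ?_⟩
    have h1 := hC _ _ ((hφL n).sub hN (hφL n₀))
    have h2 : dist (F n) (F n₀) ≤ C * dist (G n) (G n₀) := by
      rw [dist_edist, dist_edist, Lp.edist_toLp_toLp, Lp.edist_toLp_toLp]
      have := ENNReal.toReal_mono (ENNReal.mul_ne_top ENNReal.coe_ne_top
        (((hφL n).2.1.sub (hφL n₀).2.1).2.ne)) h1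
      simpa using this
    have h3 := hn₀ n hn
    rw [lt_div_iff₀ (by positivity)] at h3
    have h4 : 0 ≤ dist (G n) (G n₀) := dist_nonneg
    nlinarith
  obtain ⟨U, hU⟩ := cauchySeq_tendsto_of_complete hF
  refine ⟨U, Lp.memLp U, hg, φ, hφ, ?_, h⟩
  rw [← Lp.toLp_coeFn U (Lp.memLp U)] at hU
  exact (Lp.tendsto_Lp_iff_tendsto_eLpNorm'' _ _ _ _).1 hU

/-- The `L²` classes of Laplacians of test functions. -/
noncomputable def testLaplacians (N : ℕ) : Submodule ℝ (Lp ℝ 2 (volume : Measure (RN N))) where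
  carrier := {h | ∃ φ : RN N → ℝ, ContDiff ℝ ∞ φ ∧ HasCompactSupport φ ∧ h =ᵐ[volume] Δ φ}
  add_mem' := by
    rintro a b ⟨φ, hφ, hφc, ha⟩ ⟨ψ, hψ, hψc, hb⟩
    refine ⟨φ + ψ, hφ.add hψ, hφc.add hψc, ?_⟩
    rw [laplacian_add' hφ hψ]
    exact (Lp.coeFn_add a b).trans (ha.add hb)
  zero_mem' := ⟨0, contDiff_const, HasCompactSupport.zero, by
    have : Δ (0 : RN N → ℝ) = 0 := by
      simpa using laplacian_smul' (contDiff_const (c := (0 : ℝ)) (E := RN N) (𝕜 := ℝ) (n := ∞)) 0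
    rw [this]
    exact Lp.coeFn_zero _ _ _⟩
  smul_mem' := by
    rintro c a ⟨φ, hφ, hφc, ha⟩
    refine ⟨c • φ, contDiff_const.smul hφ, hφc.smul_left (f := fun _ => c), ?_⟩
    rw [laplacian_smul' hφ]
    exact (Lp.coeFn_smul c a).trans (ha.const_smul c)

theorem exists_hasD22Laplacian_of_mem_closure (hN : 5 ≤ N)
    {h : Lp ℝ 2 (volume : Measure (RN N))} (hh : h ∈ (testLaplacians N).topologicalClosure) :
    ∃ u, HasD22Laplacian u h := by
  obtain ⟨s, hs, hlim⟩ := mem_closure_iff_seq_limit.1 hh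
  choose φ hφ hφc hsφ using hs
  refine exists_hasD22Laplacian_of_tendsto hN (fun n => ⟨hφ n, hφc n⟩) (Lp.memLp h) ?_
  refine ((Lp.tendsto_Lp_iff_tendsto_eLpNorm' _ _).1 hlim).congr fun n => ?_
  exact eLpNorm_congr_ae ((hsφ n).sub EventuallyEq.rfl)

/-- Weak solvability of `Δ² w = f` in `𝒟^{2,2}` for `f` in the dual Lebesgue space. -/
theorem exists_weak_solution (hN : 5 ≤ N) {f : RN N → ℝ} (hf : MemLp f (critConjENN N) volume) :
    ∃ w g, HasD22Laplacian w g ∧ ∀ φ h, HasD22Laplacian φ h →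
      ∫ x, h x * g x = ∫ x, φ x * f x := by
  have := holderConjugate_critExpENN hN
  obtain ⟨C, hC⟩ := exists_sobolev hN
  -- Riesz representation takes place in this closed subspace of L². The Laplacian identifies the
  -- second-order space with it, so f acts on it through h ↦ ∫ u_h f, where Δu_h = h; Sobolev and
  -- Hölder bound this functional.
  set H := (testLaplacians N).topologicalClosure
  have hcomp : CompleteSpace H :=
    (Submodule.isClosed_topologicalClosure _).completeSpace_coe
  have hex : ∀ h : H, ∃ u, HasD22Laplacian u (h : Lp ℝ 2 (volume : Measure (RN N))) := fun h =>
    exists_hasD22Laplacian_of_mem_closure hN h.2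
  choose u hu using hex
  -- The chosen preimages depend linearly on h up to null sets, because the Laplacian determines the
  -- function.
  have hadd : ∀ a b : H, u (a + b) =ᵐ[volume] u a + u b := fun a b =>
    (hu (a + b)).eq_of_laplacian_eq hN
      (((hu a).add hN (hu b)).congr EventuallyEq.rfl (Lp.coeFn_add _ _).symm)
  have hsmul : ∀ (c : ℝ) (a : H), u (c • a) =ᵐ[volume] c • u a := fun c a =>
    (hu (c • a)).eq_of_laplacian_eq hN
      (((hu a).smul c).congr EventuallyEq.rfl (Lp.coeFn_smul _ _).symm)
  let T₀ : H →ₗ[ℝ] ℝ :=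
    { toFun := fun h => ∫ x, u h x * f x
      map_add' := fun a b => by
        rw [← integral_add (integrable_mul_of_memLp (hu a).1 hf)
          (integrable_mul_of_memLp (hu b).1 hf)]
        refine integral_congr_ae ?_
        filter_upwards [hadd a b] with x hx
        rw [hx, Pi.add_apply, add_mul]
      map_smul' := fun c a => by
        rw [RingHom.id_apply, smul_eq_mul, ← integral_const_mul]
        refine integral_congr_ae ?_
        filter_upwards [hsmul c a] with x hx
        rw [hx, Pi.smul_apply, smul_eq_mul, mul_assoc] }
  let T : H →L[ℝ] ℝ := T₀.mkContinuous (C * (eLpNorm f (critConjENN N) volume).toReal) fun h => by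
    refine (abs_integral_mul_le (hu h).1 hf).trans ?_
    have h1 := ENNReal.toReal_mono (ENNReal.mul_ne_top ENNReal.coe_ne_top (hu h).2.1.2.ne)
      (hC _ _ (hu h))
    rw [ENNReal.toReal_mul, ENNReal.coe_toReal] at h1
    rw [Submodule.coe_norm, Lp.norm_def, mul_right_comm]
    gcongr
  set G : H := (InnerProductSpace.toDual ℝ H).symm T
  refine ⟨u G, _, hu G, fun φ h hφ => ?_⟩
  have hG : ∀ a : H, inner ℝ G a = ∫ x, u a x * f x := fun a =>
    InnerProductSpace.toDual_symm_apply
  have htest : ∀ ψ : RN N → ℝ, ContDiff ℝ ∞ ψ → HasCompactSupport ψ →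
      ∫ x, Δ ψ x * (G : Lp ℝ 2 (volume : Measure (RN N))) x = ∫ x, ψ x * f x := by
    intro ψ hψ hc
    have hψL := hasD22Laplacian_of_testFunction hψ hc
    have hmem : hψL.2.1.toLp ∈ H := Submodule.le_topologicalClosure _
      ⟨ψ, hψ, hc, MemLp.coeFn_toLp _⟩
    have h1 := hG ⟨_, hmem⟩
    have h2 : u ⟨_, hmem⟩ =ᵐ[volume] ψ := (hu ⟨_, hmem⟩).eq_of_laplacian_eq hN
      (hψL.congr EventuallyEq.rfl (MemLp.coeFn_toLp hψL.2.1).symm)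
    rw [Submodule.coe_inner, L2.inner_def] at h1
    have h3 : ∫ x, u ⟨_, hmem⟩ x * f x = ∫ x, ψ x * f x :=
      integral_congr_ae (by filter_upwards [h2] with x hx; rw [hx])
    rw [← h3, ← h1]
    refine integral_congr_ae ?_
    filter_upwards [MemLp.coeFn_toLp hψL.2.1] with x hx
    simp [hx]
  -- Both sides are continuous for the approximation, so the identity extends beyond test functions;
  -- w and u themselves can then be inserted.
  obtain ⟨h1, h2, ψ, hψ, h3, h4⟩ := hφ
  have hψL := fun n => hasD22Laplacian_of_testFunction (hψ n).1 (hψ n).2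
  have t1 := tendsto_integral_mul (fun n => (hψL n).1) h1 hf h3
  have t2 := tendsto_integral_mul (fun n => (hψL n).2.1) h2 (hu G).2.1 h4
  simp only [htest _ (hψ _).1 (hψ _).2] at t2
  exact tendsto_nhds_unique t2 t1

theorem isSuperharmonic_neg_laplacian {g f : RN N → ℝ}
    (h : ∀ φ : RN N → ℝ, ContDiff ℝ ∞ φ → HasCompactSupport φ → ∫ x, Δ φ x * g x = ∫ x, φ x * f x)
    (hf : 0 ≤ᵐ[volume] f) : IsSuperharmonic (-g) := by
  intro φ hφ hc hφ0
  have h1 : ∫ x, (-g) x * Δ φ x = -∫ x, φ x * f x := by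
    rw [← h φ hφ hc, ← integral_neg]
    exact integral_congr_ae (Eventually.of_forall fun x => by simp [mul_comm])
  rw [h1, neg_nonpos]
  refine integral_nonneg_of_ae ?_
  filter_upwards [hf] with x hx using mul_nonneg (hφ0 x) hx

/-- If `Δ² w ≥ 0` then `w` is superharmonic. -/
theorem isSuperharmonic_of_weak_bilaplacian_nonneg (hN : 5 ≤ N) {w g f : RN N → ℝ}
    (hw : HasD22Laplacian w g)
    (h : ∀ φ : RN N → ℝ, ContDiff ℝ ∞ φ → HasCompactSupport φ → ∫ x, Δ φ x * g x = ∫ x, φ x * f x)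
    (hf : 0 ≤ᵐ[volume] f) : IsSuperharmonic w := by
  -- The function -Δw is superharmonic and lies in L², hence -Δw ≥ 0.
  have hg := (isSuperharmonic_neg_laplacian h hf).ae_nonneg (by omega) (p := 2)
    (by simp) (by simp) hw.2.1.neg
  intro φ hφ hc hφ0
  rw [hw.integral_mul_laplacian hN hφ hc]
  refine integral_nonpos_of_ae ?_
  filter_upwards [hg] with x hx
  exact mul_nonpos_of_nonpos_of_nonneg (by simpa using hx) (hφ0 x)

end BiharmonicCritical

namespace BiharmonicCritical

variable {N : ℕ}

/-! ### The Euler–Lagrange equation -/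

theorem HasD22Laplacian.lap_ae_eq (hN : 5 ≤ N) {u g : RN N → ℝ} (h : HasD22Laplacian u g) :
    lap u =ᵐ[volume] g := by
  have hex : MemD22 u := ⟨g, h⟩
  have : HasD22Laplacian u (lap u) := by
    rw [lap, dif_pos hex]
    exact hex.choose_spec
  exact this.unique hN h

theorem HasD22Laplacian.integral_lap_sq (hN : 5 ≤ N) {u g : RN N → ℝ}
    (h : HasD22Laplacian u g) : ∫ x, (lap u x) ^ 2 = ∫ x, (g x) ^ 2 :=
  integral_congr_ae (by filter_upwards [h.lap_ae_eq hN] with x hx; rw [hx])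

theorem HasD22Laplacian.normD22_eq (hN : 5 ≤ N) {u g : RN N → ℝ} (h : HasD22Laplacian u g) :
    normD22 u = (eLpNorm g 2 volume).toReal := by
  rw [normD22, h.integral_lap_sq hN, eLpNorm_two_eq_ofReal h.2.1,
    ENNReal.toReal_ofReal (Real.sqrt_nonneg _)]

theorem normD22_nonneg (u : RN N → ℝ) : 0 ≤ normD22 u := Real.sqrt_nonneg _

theorem HasD22Laplacian.normD22_smul (hN : 5 ≤ N) {u g : RN N → ℝ} (h : HasD22Laplacian u g)
    (c : ℝ) : normD22 (c • u) = |c| * normD22 u := by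
  rw [(h.smul c).normD22_eq hN, h.normD22_eq hN, eLpNorm_const_smul, ENNReal.toReal_mul]
  simp

theorem integrable_abs_rpow_critExp (hN : 5 ≤ N) {u : RN N → ℝ}
    (hu : MemLp u (critExpENN N) volume) : Integrable (fun x => |u x| ^ critExp N) := by
  have hq := two_lt_critExp hN
  have := hu.integrable_norm_rpow (by simpa using by linarith) (by simp)
  simpa [ENNReal.toReal_ofReal (show 0 ≤ critExp N by linarith)] using this

theorem hasDerivAt_integral_abs_rpow (hN : 5 ≤ N) {k u φ : RN N → ℝ}
    (hk : AEStronglyMeasurable k volume) {M : ℝ} (hkb : ∀ᵐ x, |k x| ≤ M)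
    (hu : MemLp u (critExpENN N) volume) (hφ : MemLp φ (critExpENN N) volume) :
    HasDerivAt (fun t : ℝ => ∫ x, k x * |u x + t * φ x| ^ critExp N)
      (critExp N * ∫ x, φ x * (k x * (|u x| ^ (critExp N - 2) * u x))) 0 := by
  have hq := two_lt_critExp hN
  set q := critExp N
  have hmem : ∀ t : ℝ, MemLp (fun x => u x + t * φ x) (critExpENN N) volume := fun t =>
    hu.add (hφ.const_mul t)
  have hint : ∀ t : ℝ, Integrable (fun x => k x * |u x + t * φ x| ^ q) := fun t =>
    (integrable_abs_rpow_critExp hN (hmem t)).bdd_mul hk hkb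
  have hcont : Continuous fun s : ℝ => |s| ^ (q - 2) * s :=
    (continuous_abs.rpow_const fun _ => Or.inr (by linarith)).mul continuous_id
  -- For |t| < 1 both |u + tφ| and |φ| are at most A = |u| + |φ|, so the t-derivative of the
  -- integrand is at most M q A^q, which is integrable.
  have key := hasDerivAt_integral_of_dominated_loc_of_deriv_le (μ := (volume : Measure (RN N)))
    (F := fun t x => k x * |u x + t * φ x| ^ q) (x₀ := (0 : ℝ)) (s := Ioo (-1) 1)
    (F' := fun t x => k x * (q * |u x + t * φ x| ^ (q - 2) * (u x + t * φ x) * φ x))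
    (bound := fun x => M * q * |(|u x| + |φ x|)| ^ q)
    (Ioo_mem_nhds (by norm_num) (by norm_num))
    (Eventually.of_forall fun t => (hint t).aestronglyMeasurable) (hint 0) ?_ ?_ ?_ ?_
  · refine key.2.congr_deriv ?_
    rw [← integral_const_mul]
    refine integral_congr_ae (Eventually.of_forall fun x => ?_)
    simp only [zero_mul, add_zero]
    ring
  · have h1 : AEStronglyMeasurable (fun x => |u x + 0 * φ x| ^ (q - 2) * (u x + 0 * φ x)) volume :=
      hcont.comp_aestronglyMeasurable (hmem 0).1
    refine (hk.mul ((h1.mul hφ.1).const_mul q)).congr (Eventually.of_forall fun x => ?_)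
    simp only [Pi.mul_apply]
    ring
  · filter_upwards [hkb] with x hx t ht
    have ht1 : |t| ≤ 1 := abs_le.2 ⟨ht.1.le, ht.2.le⟩
    set A := |u x| + |φ x| with hA
    have hA0 : 0 ≤ A := by positivity
    have h1 : |u x + t * φ x| ≤ A := by
      refine (abs_add_le _ _).trans (add_le_add_right ?_ _)
      rw [abs_mul]
      exact mul_le_of_le_one_left (abs_nonneg _) ht1
    have h2 : |φ x| ≤ A := le_add_of_nonneg_left (abs_nonneg _)
    have hM : 0 ≤ M := (abs_nonneg _).trans hx
    rw [Real.norm_eq_abs, abs_mul, abs_mul, abs_mul, abs_mul,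
      abs_of_pos (show 0 < q by linarith), abs_of_nonneg (Real.rpow_nonneg (abs_nonneg _) _),
      abs_of_nonneg hA0]
    have h3 : A ^ q = A ^ (q - 2) * A * A := by
      rcases hA0.eq_or_lt with h0 | hpos
      · rw [← h0, Real.zero_rpow (by linarith)]; simp
      · rw [mul_assoc, ← sq, ← Real.rpow_natCast A 2, ← Real.rpow_add hpos]
        norm_num
    rw [h3]
    calc |k x| * (q * |u x + t * φ x| ^ (q - 2) * |u x + t * φ x| * |φ x|)
        ≤ M * (q * A ^ (q - 2) * A * A) := by
          gcongr
      _ = _ := by ring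
  · have : MemLp (fun x => |u x| + |φ x|) (critExpENN N) volume := hu.abs.add hφ.abs
    exact (integrable_abs_rpow_critExp hN this).const_mul _
  · refine Eventually.of_forall fun x t _ => ?_
    have h1 : HasDerivAt (fun t : ℝ => u x + t * φ x) (φ x) t := by
      simpa using ((hasDerivAt_id t).mul_const (φ x)).const_add (u x)
    exact (((hasDerivAt_abs_rpow (u x + t * φ x) (by linarith : 1 < q)).comp t h1)).const_mul _

theorem hasDerivAt_integral_add_smul_sq {g h : RN N → ℝ} (hg : MemLp g 2 volume)
    (hh : MemLp h 2 volume) :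
    HasDerivAt (fun t : ℝ => ∫ x, (g x + t * h x) ^ 2) (2 * ∫ x, h x * g x) 0 := by
  have hexp : (fun t : ℝ => ∫ x, (g x + t * h x) ^ 2) =
      fun t => (∫ x, (g x) ^ 2) + t * (2 * ∫ x, h x * g x) + t ^ 2 * ∫ x, (h x) ^ 2 := by
    funext t
    have h1 := hg.integrable_sq
    have h2 := hh.integrable_sq
    have h3 : Integrable (fun x => h x * g x) := integrable_mul_of_memLp hh hg
    have h4 : Integrable (fun x => (g x) ^ 2 + t * (2 * (h x * g x))) :=
      h1.add ((h3.const_mul 2).const_mul t)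
    rw [← integral_const_mul, ← integral_const_mul, ← integral_const_mul,
      ← integral_add h1 ((h3.const_mul 2).const_mul t), ← integral_add h4 (h2.const_mul (t ^ 2))]
    refine integral_congr_ae (Eventually.of_forall fun x => ?_)
    ring
  rw [hexp]
  have h1 := ((hasDerivAt_id (0 : ℝ)).mul_const (2 * ∫ x, h x * g x)).const_add
    (∫ x, (g x) ^ 2)
  have h2 := (hasDerivAt_pow 2 (0 : ℝ)).mul_const (∫ x, (h x) ^ 2)
  refine (h1.add h2).congr_deriv ?_
  simp

/-- A critical point of the energy solves the Euler–Lagrange equation weakly. -/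
theorem IsCriticalPoint.weak_equation (hN : 5 ≤ N) {K : RN N → ℝ} {ε : ℝ} {u g : RN N → ℝ}
    (hK : AEStronglyMeasurable K volume) {M : ℝ} (hKb : ∀ᵐ x, |1 + ε * K x| ≤ M)
    (hcrit : IsCriticalPoint K ε u) (hu : HasD22Laplacian u g) {φ h : RN N → ℝ}
    (hφ : HasD22Laplacian φ h) :
    ∫ x, h x * g x = ∫ x, φ x * ((1 + ε * K x) * (|u x| ^ (critExp N - 2) * u x)) := by
  have hq := two_lt_critExp hN
  have hk : AEStronglyMeasurable (fun x => 1 + ε * K x) volume :=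
    aestronglyMeasurable_const.add (hK.const_mul ε)
  set D := (∫ x, h x * g x) - ∫ x, φ x * ((1 + ε * K x) * (|u x| ^ (critExp N - 2) * u x)) with hD
  have henergy : (fun t : ℝ => energy K ε (u + t • φ)) = fun t : ℝ =>
      1 / 2 * (∫ x, (g x + t * h x) ^ 2) -
        1 / critExp N * ∫ x, (1 + ε * K x) * |u x + t * φ x| ^ critExp N := by
    funext t
    rw [energy, (hu.add hN (hφ.smul t)).integral_lap_sq hN]
    simp
  have hderiv : HasDerivAt (fun t : ℝ => energy K ε (u + t • φ)) D 0 := by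
    rw [henergy]
    have h1 := (hasDerivAt_integral_add_smul_sq hu.2.1 hφ.2.1).const_mul (1 / 2 : ℝ)
    have h2 := (hasDerivAt_integral_abs_rpow hN hk hKb hu.1 hφ.1).const_mul (1 / critExp N)
    refine (h1.sub h2).congr_deriv ?_
    rw [hD]
    have : critExp N ≠ 0 := by linarith
    field_simp
  suffices hD0 : D = 0 by linarith
  -- Along the line tφ the Fréchet condition bounds the difference quotients, whose limit is D, by
  -- η‖φ‖.
  have hbound : ∀ η > 0, |D| ≤ η * normD22 φ := by
    intro η hη
    obtain ⟨δ, hδ, hδ'⟩ := hcrit.2 η hη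
    have hslope := hderiv.tendsto_slope_zero.norm
    refine le_of_tendsto hslope ?_
    have hsmall : ∀ᶠ t : ℝ in 𝓝[≠] 0, |t| * normD22 φ ≤ δ := by
      have : Tendsto (fun t : ℝ => |t| * normD22 φ) (𝓝 0) (𝓝 (|0| * normD22 φ)) :=
        (continuous_abs.mul continuous_const).tendsto 0
      rw [abs_zero, zero_mul] at this
      exact ((this.eventually (Iio_mem_nhds hδ)).mono fun t ht => le_of_lt ht).filter_mono
        nhdsWithin_le_nhds
    filter_upwards [hsmall, self_mem_nhdsWithin] with t ht ht0
    have ht0' : 0 < |t| := abs_pos.2 ht0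
    have h1 := hδ' (t • φ) ⟨_, hφ.smul t⟩ (by rwa [hφ.normD22_smul hN])
    rw [hφ.normD22_smul hN] at h1
    rw [norm_smul, norm_inv, Real.norm_eq_abs, Real.norm_eq_abs, inv_mul_le_iff₀ ht0']
    simp only [zero_add, zero_smul, add_zero]
    linarith
  by_contra hne
  have hpos : 0 < |D| := abs_pos.2 hne
  have h0 := normD22_nonneg φ
  -- The summand 1 covers the case ‖φ‖ = 0.
  have h1 := hbound (|D| / (2 * (normD22 φ + 1))) (by positivity)
  rw [div_mul_eq_mul_div, le_div_iff₀ (by positivity)] at h1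
  nlinarith

end BiharmonicCritical

namespace BiharmonicCritical

variable {N : ℕ}

/-! ### Positivity of solutions with a small negative part -/

/-- The conjugate exponent is q/(q-1), so s ↦ |s|^{q-1} maps L^q into its dual. This makes the
nonlinearity and its truncation admissible right-hand sides. -/
theorem critExpENN_eq_mul (hN : 5 ≤ N) :
    critConjENN N * ENNReal.ofReal (critExp N - 1) = critExpENN N := by
  have hq := two_lt_critExp hN
  have h1 : 0 ≤ Real.conjExponent (critExp N) := (holderConjugate_critExp hN).symm.nonneg
  rw [← ENNReal.ofReal_mul h1, Real.conjExponent, div_mul_cancel₀ _ (by linarith)]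

theorem eLpNorm_rpow_critExp_sub_one (hN : 5 ≤ N) (s : RN N → ℝ) :
    eLpNorm (fun x => ‖s x‖ ^ (critExp N - 1)) (critConjENN N) volume =
      eLpNorm s (critExpENN N) volume ^ (critExp N - 1) := by
  have hq := two_lt_critExp hN
  rw [eLpNorm_norm_rpow s (by linarith), critExpENN_eq_mul hN]

theorem memLp_rpow_critExp_sub_one (hN : 5 ≤ N) {s : RN N → ℝ}
    (hs : MemLp s (critExpENN N) volume) :
    MemLp (fun x => ‖s x‖ ^ (critExp N - 1)) (critConjENN N) volume := by
  have hq := two_lt_critExp hN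
  refine ⟨(continuous_norm.rpow_const fun _ => Or.inr (by linarith)).comp_aestronglyMeasurable
    hs.1, ?_⟩
  rw [eLpNorm_rpow_critExp_sub_one hN]
  exact ENNReal.rpow_lt_top_of_nonneg (by linarith) hs.2.ne

theorem toReal_eLpNorm_critExp_rpow (hN : 5 ≤ N) {s : RN N → ℝ}
    (hs : MemLp s (critExpENN N) volume) :
    (eLpNorm s (critExpENN N) volume).toReal ^ critExp N = ∫ x, |s x| ^ critExp N := by
  have hq := two_lt_critExp hN
  have h0 : 0 ≤ ∫ x, |s x| ^ critExp N :=
    integral_nonneg fun _ => Real.rpow_nonneg (abs_nonneg _) _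
  rw [hs.eLpNorm_eq_integral_rpow_norm (by simpa using by linarith) (by simp),
    ENNReal.toReal_ofReal (show 0 ≤ critExp N by linarith)]
  simp only [Real.norm_eq_abs]
  rw [ENNReal.toReal_ofReal (by positivity), ← Real.rpow_mul h0, inv_mul_cancel₀ (by linarith),
    Real.rpow_one]

/-- The negative part. -/
noncomputable def negPart (u : RN N → ℝ) (x : RN N) : ℝ := max (-u x) 0

theorem negPart_nonneg (u : RN N → ℝ) (x : RN N) : 0 ≤ negPart u x := le_max_right _ _

theorem memLp_negPart {u : RN N → ℝ} {p : ENNReal} (hu : MemLp u p volume) :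
    MemLp (negPart u) p volume := by
  refine hu.mono (hu.1.neg.sup aestronglyMeasurable_const) (Eventually.of_forall fun x => ?_)
  rw [Real.norm_eq_abs, Real.norm_eq_abs, abs_of_nonneg (negPart_nonneg u x)]
  exact max_le (neg_le_abs _) (abs_nonneg _)

theorem mul_negPart_rpow {q : ℝ} (hq : 2 < q) (u : RN N → ℝ) (x : RN N) :
    u x * negPart u x ^ (q - 1) = -negPart u x ^ q := by
  unfold negPart
  rcases le_total (u x) 0 with h | h
  · rw [max_eq_left (by linarith)]
    rcases h.eq_or_lt with h0 | h0
    · rw [h0]; simp [Real.zero_rpow (show q ≠ 0 by linarith)]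
    · have h1 : 0 < -u x := by linarith
      have h2 : (-u x) ^ q = (-u x) ^ (q - 1) * (-u x) := by
        rw [← Real.rpow_add_one h1.ne']; norm_num
      rw [h2]; ring
  · rw [max_eq_right (by linarith), Real.zero_rpow (by linarith), Real.zero_rpow (by linarith)]
    simp

/-- Equality holds where u ≤ 0; elsewhere the left side is 0. -/
theorem neg_negPart_rpow_le {q : ℝ} (hq : 2 < q) (u : RN N → ℝ) (x : RN N) :
    -negPart u x ^ (q - 1) ≤ |u x| ^ (q - 2) * u x := by
  unfold negPart
  rcases le_total (u x) 0 with h | h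
  · rw [max_eq_left (by linarith), abs_of_nonpos h]
    rcases h.eq_or_lt with h0 | h0
    · rw [h0]; simp [Real.zero_rpow (show q - 1 ≠ 0 by linarith)]
    · have h1 : 0 < -u x := by linarith
      have h2 : (-u x) ^ (q - 1) = (-u x) ^ (q - 2) * (-u x) := by
        rw [← Real.rpow_add_one h1.ne']; congr 1; ring
      rw [h2]; linarith
  · rw [max_eq_right (by linarith), Real.zero_rpow (by linarith)]
    simp only [neg_zero]
    positivity

/-- `u ∈ 𝒟^{2,2}`, with Laplacian `g`, solves `Δ² u = k |u|^{2^*-2} u` weakly. -/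
def IsWeakSolution (k u g : RN N → ℝ) : Prop :=
  HasD22Laplacian u g ∧ ∀ φ h, HasD22Laplacian φ h →
    ∫ x, h x * g x = ∫ x, φ x * (k x * (|u x| ^ (critExp N - 2) * u x))

theorem abs_rpow_sub_two_mul_abs {q : ℝ} (hq : 2 < q) (s : ℝ) :
    |(|s| ^ (q - 2) * s)| = ‖s‖ ^ (q - 1) := by
  rw [abs_mul, abs_of_nonneg (Real.rpow_nonneg (abs_nonneg _) _), Real.norm_eq_abs]
  rcases eq_or_ne s 0 with rfl | h
  · simp [Real.zero_rpow (show q - 1 ≠ 0 by linarith)]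
  · rw [← Real.rpow_add_one (abs_pos.2 h).ne']; congr 1; ring

/-- A weak solution whose negative part is small in `L^{2^*}` is nonnegative. -/
theorem exists_ae_nonneg_of_negPart_small (hN : 5 ≤ N) : ∃ δ : ℝ, 0 < δ ∧
    ∀ k u g : RN N → ℝ, AEStronglyMeasurable k volume → (∀ᵐ x, 1 / 2 ≤ k x ∧ k x ≤ 2) →
      IsWeakSolution k u g → (eLpNorm (negPart u) (critExpENN N) volume).toReal < δ →
      0 ≤ᵐ[volume] u := by
  have hq := two_lt_critExp hN
  have := holderConjugate_critExpENN hN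
  obtain ⟨C, hC⟩ := exists_sobolev hN
  -- A nonzero a will satisfy 1/2 ≤ 4C²a^{q-2}, which is impossible when a^{q-2} < 1/(8(C+1)²). The
  -- summand 1 keeps the threshold meaningful if C = 0.
  refine ⟨(1 / (8 * ((C : ℝ) + 1) ^ 2)) ^ (1 / (critExp N - 2)), by positivity,
    fun k u g hk hkb hu hsmall => ?_⟩
  set q := critExp N
  set a := (eLpNorm (negPart u) (critExpENN N) volume).toReal with ha
  have ha0 : 0 ≤ a := ENNReal.toReal_nonneg
  have hum : MemLp (negPart u) (critExpENN N) volume := memLp_negPart hu.1.1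
  have hkabs : ∀ᵐ x, ‖k x‖ ≤ 2 := by
    filter_upwards [hkb] with x hx
    rw [Real.norm_eq_abs, abs_of_nonneg (by linarith)]
    exact hx.2
  have hpm : MemLp (fun x => ‖negPart u x‖ ^ (q - 1)) (critConjENN N) volume :=
    memLp_rpow_critExp_sub_one hN hum
  have hnorm : ∀ x, ‖negPart u x‖ = negPart u x := fun x =>
    Real.norm_of_nonneg (negPart_nonneg u x)
  set f : RN N → ℝ := fun x => k x * ‖negPart u x‖ ^ (q - 1) with hf
  have hfb : ∀ᵐ x, ‖f x‖ ≤ 2 * ‖‖negPart u x‖ ^ (q - 1)‖ := by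
    filter_upwards [hkabs] with x hx
    rw [hf, norm_mul]
    gcongr
  have hfm : MemLp f (critConjENN N) volume := hpm.of_le_mul (hk.mul hpm.1) hfb
  have hf0 : 0 ≤ᵐ[volume] f := by
    filter_upwards [hkb] with x hx
    exact mul_nonneg (by linarith) (Real.rpow_nonneg (norm_nonneg _) _)
  obtain ⟨w, gw, hw, hweq⟩ := exists_weak_solution hN hfm
  have hwsup : IsSuperharmonic w := isSuperharmonic_of_weak_bilaplacian_nonneg hN hw
    (fun φ hφ hc => hweq φ _ (hasD22Laplacian_of_testFunction hφ hc)) hf0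
  have hw0 := hwsup.ae_nonneg (by omega) (one_le_critExpENN hN) (by simp) hw.1
  set b := (eLpNorm gw 2 volume).toReal with hb
  have hb0 : 0 ≤ b := ENNReal.toReal_nonneg
  have hbsq : b ^ 2 = ∫ x, w x * f x := by
    rw [← hweq w gw hw, hb, eLpNorm_two_eq_ofReal hw.2.1,
      ENNReal.toReal_ofReal (Real.sqrt_nonneg _), Real.sq_sqrt (integral_nonneg fun _ => sq_nonneg _)]
    simp only [sq]
  have hfnorm : (eLpNorm f (critConjENN N) volume).toReal ≤ 2 * a ^ (q - 1) := by
    have h1 := eLpNorm_le_mul_eLpNorm_of_ae_le_mul hfb (critConjENN N)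
    rw [eLpNorm_rpow_critExp_sub_one hN] at h1
    have h2 := ENNReal.toReal_mono (ENNReal.mul_ne_top ENNReal.ofReal_ne_top
      (ENNReal.rpow_ne_top_of_nonneg (by linarith) hum.2.ne)) h1
    simpa [ENNReal.toReal_mul, ← ENNReal.toReal_rpow] using h2
  have hwnorm : (eLpNorm w (critExpENN N) volume).toReal ≤ C * b := by
    have h1 := ENNReal.toReal_mono (ENNReal.mul_ne_top ENNReal.coe_ne_top hw.2.1.2.ne)
      (hC _ _ hw)
    simpa using h1
  have hap : 0 ≤ a ^ (q - 1) := Real.rpow_nonneg ha0 _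
  -- The equation of w tested with w gives b² = ∫ w f; Hölder and Sobolev bound this by Cb ·
  -- 2a^{q-1}, and one factor b cancels.
  have hb1 : b ≤ 2 * C * a ^ (q - 1) := by
    have h1 : b ^ 2 ≤ (C * b) * (2 * a ^ (q - 1)) := by
      rw [hbsq]
      refine (le_abs_self _).trans ((abs_integral_mul_le hw.1 hfm).trans ?_)
      gcongr
    rcases hb0.eq_or_lt with h0 | h0
    · rw [← h0]; positivity
    · nlinarith
  -- The pairing of Δu and Δw is computed in two ways: here from the equation of w tested with u.
  have h2 : ∫ x, g x * gw x = ∫ x, u x * f x := hweq u g hu.1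
  have h3 : 1 / 2 * a ^ q ≤ -∫ x, u x * f x := by
    rw [ha, toReal_eLpNorm_critExp_rpow hN hum, ← integral_const_mul, ← integral_neg]
    refine integral_mono_ae ((integrable_abs_rpow_critExp hN hum).const_mul _)
      (integrable_mul_of_memLp hu.1.1 hfm).neg ?_
    filter_upwards [hkb] with x hx
    have e1 := mul_negPart_rpow hq u x
    have e2 : 0 ≤ negPart u x ^ q := Real.rpow_nonneg (negPart_nonneg u x) _
    simp only [hf, hnorm, abs_of_nonneg (negPart_nonneg u x)]
    have e3 : -(u x * (k x * negPart u x ^ (q - 1))) = k x * negPart u x ^ q := by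
      linear_combination (-k x) * e1
    rw [e3]
    exact mul_le_mul_of_nonneg_right hx.1 e2
  have hcontq : Continuous fun s : ℝ => |s| ^ (q - 2) * s :=
    (continuous_abs.rpow_const fun _ => Or.inr (by linarith)).mul continuous_id
  have hrhs : MemLp (fun x => k x * (|u x| ^ (q - 2) * u x)) (critConjENN N) volume := by
    refine (memLp_rpow_critExp_sub_one hN hu.1.1).of_le_mul (c := 2)
      (hk.mul (hcontq.comp_aestronglyMeasurable hu.1.1.1)) ?_
    filter_upwards [hkabs] with x hx
    rw [norm_mul, Real.norm_eq_abs (|u x| ^ (q - 2) * u x), abs_rpow_sub_two_mul_abs hq,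
      Real.norm_of_nonneg (Real.rpow_nonneg (norm_nonneg (u x)) _)]
    gcongr
  -- The second computation uses the equation of u tested with w. The sign w ≥ 0 allows the
  -- nonlinearity to be replaced by its lower bound -(u⁻)^{q-1}.
  have h4 : -∫ x, w x * f x ≤ ∫ x, gw x * g x := by
    rw [hu.2 w gw hw, ← integral_neg]
    refine integral_mono_ae (integrable_mul_of_memLp hw.1 hfm).neg
      (integrable_mul_of_memLp hw.1 hrhs) ?_
    filter_upwards [hkb, hw0] with x hx hwx
    have e1 := neg_negPart_rpow_le hq u x
    have e2 : 0 ≤ w x * k x := mul_nonneg hwx (by linarith)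
    simp only [hf, hnorm]
    nlinarith [mul_le_mul_of_nonneg_left e1 e2]
  have h5 : ∫ x, gw x * g x = ∫ x, g x * gw x := by simp only [mul_comm]
  have h6 : 1 / 2 * a ^ q ≤ b ^ 2 := by linarith
  have haz : a = 0 := by
    by_contra hne
    have hapos : 0 < a := lt_of_le_of_ne ha0 (Ne.symm hne)
    have e1 : b ^ 2 ≤ (2 * C * a ^ (q - 1)) ^ 2 := by gcongr
    have e2 : (a ^ (q - 1)) ^ 2 = a ^ (q - 2) * a ^ q := by
      rw [← Real.rpow_natCast, ← Real.rpow_mul ha0, ← Real.rpow_add hapos]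
      congr 1; push_cast; ring
    have e3 : 0 < a ^ q := Real.rpow_pos_of_pos hapos _
    have e4 : a ^ (q - 2) < 1 / (8 * ((C : ℝ) + 1) ^ 2) := by
      have := Real.rpow_lt_rpow ha0 hsmall (show 0 < q - 2 by linarith)
      rwa [← Real.rpow_mul (by positivity), one_div_mul_cancel (by linarith), Real.rpow_one] at this
    have e5 : 1 / 2 * a ^ q ≤ 4 * (C : ℝ) ^ 2 * a ^ (q - 2) * a ^ q := by
      calc _ ≤ _ := h6.trans e1
        _ = _ := by rw [mul_pow, e2]; ring
    have e6 : 1 / 2 ≤ 4 * (C : ℝ) ^ 2 * a ^ (q - 2) := le_of_mul_le_mul_right e5 e3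
    rw [lt_div_iff₀ (by positivity)] at e4
    have hC0 : (0 : ℝ) ≤ C := C.2
    have e7 : 0 < a ^ (q - 2) := Real.rpow_pos_of_pos hapos _
    nlinarith
  have hz : eLpNorm (negPart u) (critExpENN N) volume = 0 :=
    ((ENNReal.toReal_eq_zero_iff _).1 haz).resolve_right hum.2.ne
  have hz' := (eLpNorm_eq_zero_iff hum.1
    (zero_lt_one.trans_le (one_le_critExpENN hN)).ne').1 hz
  filter_upwards [hz'] with x hx
  have := le_max_left (-u x) 0
  rw [negPart, Pi.zero_apply] at hx
  rw [Pi.zero_apply]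
  linarith

/-- A nonnegative nonzero weak solution is positive. -/
theorem IsWeakSolution.pos_of_nonneg (hN : 5 ≤ N) {k u g : RN N → ℝ} (hu : IsWeakSolution k u g)
    (hk : ∀ᵐ x, 0 ≤ k x) (hu0 : 0 ≤ᵐ[volume] u) (hne : ¬ u =ᵐ[volume] 0) :
    (∀ᵐ x, 0 < u x) ∧ ∀ w : RN N → ℝ, Continuous w → w =ᵐ[volume] u → ∀ x, 0 < w x := by
  have hs : IsSuperharmonic u := isSuperharmonic_of_weak_bilaplacian_nonneg hN hu.1
    (fun φ hφ hc => hu.2 φ _ (hasD22Laplacian_of_testFunction hφ hc)) (by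
      filter_upwards [hk, hu0] with x hx hux
      exact mul_nonneg hx (mul_nonneg (Real.rpow_nonneg (abs_nonneg _) _) hux))
  exact hs.ae_pos (by omega) (one_le_critExpENN hN) (by simp) hu.1.1 hne

end BiharmonicCritical

namespace BiharmonicCritical

variable {N : ℕ}

/-! ### Bubbles -/

theorem bubbleConst_pos (hN : 5 ≤ N) : 0 < bubbleConst N := by
  have h5 : (5 : ℝ) ≤ N := by exact_mod_cast hN
  have h1 : 0 < (N : ℝ) - 4 := by linarith
  have h2 : 0 < (N : ℝ) - 2 := by linarith
  exact Real.rpow_pos_of_pos (by positivity) _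

theorem bubble_nonneg (hN : 5 ≤ N) (y : RN N) {l : ℝ} (hl : 0 < l) (x : RN N) :
    0 ≤ bubble y l x := by
  have := bubbleConst_pos hN
  unfold bubble
  positivity

theorem le_bubble_of_mem_closedBall (hN : 5 ≤ N) {y x : RN N} {l : ℝ} (hl : 0 < l)
    (hx : x ∈ Metric.closedBall y (1 / l)) :
    bubbleConst N * l ^ (((N : ℝ) - 4) / 2) / 2 ^ (((N : ℝ) - 4) / 2) ≤ bubble y l x := by
  have h5 : (5 : ℝ) ≤ N := by exact_mod_cast hN
  have hc := bubbleConst_pos hN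
  have h1 : l ^ 2 * ‖x - y‖ ^ 2 ≤ 1 := by
    rw [Metric.mem_closedBall, dist_eq_norm, le_div_iff₀ hl] at hx
    rw [← mul_pow, mul_comm l]
    exact pow_le_one₀ (by positivity) hx
  unfold bubble
  gcongr
  · linarith
  · linarith

/-- On the ball of radius 1/l around y the bubble is at least a constant times l^{(N-4)/2}, while
the volume of the ball contributes l^{-N/q} = l^{-(N-4)/2} to the L^q norm. The powers of l cancel,
so c is independent of y and l. -/
theorem exists_le_eLpNorm_of_bubble_le (hN : 5 ≤ N) : ∃ c : ℝ, 0 < c ∧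
    ∀ (y : RN N) (l : ℝ), 0 < l → ∀ s : RN N → ℝ, MemLp s (critExpENN N) volume →
      (∀ᵐ x, 1 / 2 * bubble y l x ≤ |s x|) → c ≤ (eLpNorm s (critExpENN N) volume).toReal := by
  have h5 : (5 : ℝ) ≤ N := by exact_mod_cast hN
  have hq := two_lt_critExp hN
  have hcN := bubbleConst_pos hN
  set D := (volume (Metric.ball (0 : RN N) 1)).toReal
  have hD : 0 < D := ENNReal.toReal_pos
    (Metric.measure_ball_pos _ _ one_pos).ne' measure_ball_lt_top.ne
  refine ⟨1 / 2 * (bubbleConst N / 2 ^ (((N : ℝ) - 4) / 2)) * D ^ (1 / critExp N), by positivity,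
    fun y l hl s hs hle => ?_⟩
  set B := Metric.closedBall y (1 / l)
  set m := 1 / 2 * (bubbleConst N * l ^ (((N : ℝ) - 4) / 2) / 2 ^ (((N : ℝ) - 4) / 2))
  have hm : 0 ≤ m := by positivity
  have h1 : eLpNorm (B.indicator fun _ => m) (critExpENN N) volume ≤
      eLpNorm s (critExpENN N) volume := by
    refine eLpNorm_mono_ae ?_
    filter_upwards [hle] with x hx
    by_cases hxB : x ∈ B
    · rw [indicator_of_mem hxB, Real.norm_of_nonneg hm, Real.norm_eq_abs]
      exact (mul_le_mul_of_nonneg_left (le_bubble_of_mem_closedBall hN hl hxB)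
        (by norm_num)).trans hx
    · rw [indicator_of_notMem hxB]; simp
  rw [eLpNorm_indicator_const Metric.isClosed_closedBall.measurableSet
    (zero_lt_one.trans_le (one_le_critExpENN hN)).ne' (by simp),
    ENNReal.toReal_ofReal (by linarith)] at h1
  have h2 := ENNReal.toReal_mono hs.2.ne h1
  rw [ENNReal.toReal_mul, ← ENNReal.toReal_rpow, volume_real_closedBall y hl, toReal_enorm,
    Real.norm_of_nonneg hm] at h2
  refine le_trans (le_of_eq ?_) h2
  have hexp : ((l ^ N)⁻¹ : ℝ) ^ (1 / critExp N) = (l ^ (((N : ℝ) - 4) / 2))⁻¹ := by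
    rw [← Real.rpow_natCast, ← Real.rpow_neg hl.le, ← Real.rpow_neg hl.le, ← Real.rpow_mul hl.le]
    congr 1
    have : (N : ℝ) - 4 ≠ 0 := by linarith
    rw [critExp]
    field_simp
  rw [Real.mul_rpow (by positivity) hD.le, hexp]
  have : l ^ (((N : ℝ) - 4) / 2) ≠ 0 := by positivity
  simp only [m]
  field_simp

theorem negPart_twoPeak_le (hN : 5 ≤ N) {α : Fin 2 → ℝ} (hα : ∀ j, 0 ≤ α j) (y : Fin 2 → RN N)
    {l : Fin 2 → ℝ} (hl : ∀ j, 0 < l j) (v : RN N → ℝ) (x : RN N) :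
    negPart (twoPeak α y l v) x ≤ |v x| := by
  have h : 0 ≤ ∑ j, α j * bubble (y j) (l j) x :=
    Finset.sum_nonneg fun j _ => mul_nonneg (hα j) (bubble_nonneg hN _ (hl j) x)
  unfold negPart twoPeak
  refine max_le ?_ (abs_nonneg _)
  linarith [neg_le_abs (v x)]

theorem bubble_le_of_twoPeak_eq_zero (hN : 5 ≤ N) {α : Fin 2 → ℝ} (hα : ∀ j, 1 / 2 ≤ α j)
    {y : Fin 2 → RN N} {l : Fin 2 → ℝ} (hl : ∀ j, 0 < l j) {v : RN N → ℝ} {x : RN N}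
    (h : twoPeak α y l v x = 0) : 1 / 2 * bubble (y 0) (l 0) x ≤ |v x| := by
  have h0 := bubble_nonneg hN (y 0) (hl 0) x
  have h1 := bubble_nonneg hN (y 1) (hl 1) x
  rw [twoPeak, Fin.sum_univ_two] at h
  have h2 : 0 ≤ α 1 * bubble (y 1) (l 1) x := mul_nonneg (by linarith [hα 1]) h1
  have h3 : 1 / 2 * bubble (y 0) (l 0) x ≤ α 0 * bubble (y 0) (l 0) x :=
    mul_le_mul_of_nonneg_right (hα 0) h0
  linarith [neg_le_abs (v x)]

theorem tendsto_remainderBound (hN : 5 ≤ N) {z : Fin 2 → RN N} {β : Fin 2 → ℝ}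
    (hβ : ∀ j, 0 < β j) {τ : ℝ} (hτ : 0 < τ) {y : ℝ → Fin 2 → RN N} {l : ℝ → Fin 2 → ℝ}
    (hy : ∀ j, Tendsto (fun ε => y ε j) (𝓝[>] 0) (𝓝 (z j)))
    (hl : ∀ j, Tendsto (fun ε => l ε j) (𝓝[>] 0) atTop) :
    Tendsto (fun ε => remainderBound z β τ ε (y ε) (l ε)) (𝓝[>] 0) (𝓝 0) := by
  have h5 : (5 : ℝ) ≤ N := by exact_mod_cast hN
  have hinv : ∀ {f : ℝ → ℝ} {r : ℝ}, 0 < r → Tendsto f (𝓝[>] 0) atTop →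
      Tendsto (fun ε => 1 / f ε ^ r) (𝓝[>] 0) (𝓝 0) := fun hr hf => by
    simp only [one_div]
    exact ((tendsto_rpow_atTop hr).comp hf).inv_tendsto_atTop
  have hpow : ∀ {f : ℝ → ℝ} {r : ℝ}, 0 < r → Tendsto f (𝓝[>] 0) (𝓝 0) →
      Tendsto (fun ε => f ε ^ r) (𝓝[>] 0) (𝓝 0) := fun {f r} hr hf => by
    have := hf.rpow_const (p := r) (Or.inr hr.le)
    rwa [Real.zero_rpow hr.ne'] at this
  have hε : Tendsto (fun ε : ℝ => ε) (𝓝[>] 0) (𝓝 0) := nhdsWithin_le_nhds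
  have h1 : ∀ j, Tendsto (fun ε => ‖y ε j - z j‖ ^ β j +
      1 / l ε j ^ min (β j) (((N : ℝ) + 4) / 2)) (𝓝[>] 0) (𝓝 0) := fun j => by
    have := (hpow (hβ j) (tendsto_iff_norm_sub_tendsto_zero.1 (hy j))).add
      (hinv (lt_min (hβ j) (by linarith : 0 < ((N : ℝ) + 4) / 2)) (hl j))
    simpa using this
  have h2 := hε.mul (tendsto_finsetSum Finset.univ fun j _ => h1 j)
  have h3 : Tendsto (fun ε => interaction N (l ε)) (𝓝[>] 0) (𝓝 0) :=
    hinv (by linarith) ((hl 0).atTop_mul_atTop₀ (hl 1))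
  have h4 := h2.add (hpow (by linarith : 0 < 1 / 2 + τ) h3)
  simpa [remainderBound] using h4

theorem eventually_half_le_one_add_mul (K : RN N → ℝ) (hKb : MemLp K ⊤ volume) :
    ∀ᶠ ε in 𝓝[>] (0 : ℝ), ∀ᵐ x, 1 / 2 ≤ 1 + ε * K x ∧ 1 + ε * K x ≤ 2 := by
  set M := (eLpNorm K ⊤ volume).toReal
  have hM0 : 0 ≤ M := ENNReal.toReal_nonneg
  have hM : ∀ᵐ x, |K x| ≤ M := by
    have hfin := hKb.2.ne
    filter_upwards [ae_le_eLpNormEssSup (f := K) (μ := (volume : Measure (RN N)))] with x hx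
    rw [← eLpNorm_exponent_top] at hx
    have := ENNReal.toReal_mono hfin hx
    rwa [toReal_enorm] at this
  have h1 : Ioo (0 : ℝ) (1 / (2 * (M + 1))) ∈ 𝓝[>] (0 : ℝ) := Ioo_mem_nhdsGT (by positivity)
  filter_upwards [h1] with ε hε
  filter_upwards [hM] with x hx
  have h2 := hε.2
  rw [lt_div_iff₀ (by positivity)] at h2
  have h3 : |ε * K x| ≤ 1 / 2 := by
    rw [abs_mul, abs_of_pos hε.1]
    nlinarith [mul_le_mul_of_nonneg_left hx hε.1.le, hε.1]
  have h4 := abs_le.1 h3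
  constructor <;> linarith

end BiharmonicCritical

/-! ### Positivity of the two-peak critical points -/

theorem proposition3p1 (N : ℕ) (hN : 5 ≤ N)
    (K : BiharmonicCritical.RN N → ℝ) (hK : ContDiff ℝ 1 K) (hKb : MemLp K ⊤ volume)
    (z : Fin 2 → BiharmonicCritical.RN N) (hz : z 0 ≠ z 1) (β : Fin 2 → ℝ)
    (hzβ : ∀ j, BiharmonicCritical.MemSigma K (z j) (β j))
    (ε₁ : ℝ) (hε₁ : 0 < ε₁)
    (α : ℝ → Fin 2 → ℝ) (y : ℝ → Fin 2 → BiharmonicCritical.RN N) (l : ℝ → Fin 2 → ℝ)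
    (v : ℝ → BiharmonicCritical.RN N → ℝ)
    (hα : ∀ j, Tendsto (fun ε => α ε j) (𝓝[>] 0) (𝓝 1))
    (hy : ∀ j, Tendsto (fun ε => y ε j) (𝓝[>] 0) (𝓝 (z j)))
    (hl : ∀ j, Tendsto (fun ε => l ε j) (𝓝[>] 0) atTop)
    (hv : ∀ ε ∈ Ioo 0 ε₁, BiharmonicCritical.MemD22 (v ε))
    (τ : ℝ) (hτ : 0 < τ)
    (hest : (fun ε => BiharmonicCritical.normD22 (v ε)) =O[𝓝[>] 0]
      (fun ε => BiharmonicCritical.remainderBound z β τ ε (y ε) (l ε)))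
    (hcrit : ∀ ε ∈ Ioo 0 ε₁, BiharmonicCritical.IsCriticalPoint K ε
      (BiharmonicCritical.twoPeak (α ε) (y ε) (l ε) (v ε))) :
    ∃ ε₀ ∈ Ioc 0 ε₁, ∀ ε ∈ Ioo 0 ε₀,
      (∀ᵐ x, 0 < BiharmonicCritical.twoPeak (α ε) (y ε) (l ε) (v ε) x) ∧
      ∀ w : BiharmonicCritical.RN N → ℝ, Continuous w →
        w =ᵐ[volume] BiharmonicCritical.twoPeak (α ε) (y ε) (l ε) (v ε) → ∀ x, 0 < w x := by
  obtain ⟨C, hC⟩ := BiharmonicCritical.exists_sobolev hN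
  obtain ⟨δ, hδ, hpos⟩ := BiharmonicCritical.exists_ae_nonneg_of_negPart_small hN
  obtain ⟨c, hc, hlow⟩ := BiharmonicCritical.exists_le_eLpNorm_of_bubble_le hN
  -- The remainder estimate enters only through the convergence of its right-hand side to 0; the
  -- rate plays no role.
  have hv0 : Tendsto (fun ε => BiharmonicCritical.normD22 (v ε)) (𝓝[>] 0) (𝓝 0) :=
    hest.trans_tendsto (BiharmonicCritical.tendsto_remainderBound hN
      (fun j => lt_trans one_pos (hzβ j).2.1) hτ hy hl)
  have hCv0 : Tendsto (fun ε => (C : ℝ) * BiharmonicCritical.normD22 (v ε)) (𝓝[>] 0) (𝓝 0) := by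
    simpa using hv0.const_mul (C : ℝ)
  have hev : ∀ᶠ ε in 𝓝[>] (0 : ℝ), ε ∈ Ioo 0 ε₁ →
      (∀ᵐ x, 0 < BiharmonicCritical.twoPeak (α ε) (y ε) (l ε) (v ε) x) ∧
      ∀ w : BiharmonicCritical.RN N → ℝ, Continuous w →
        w =ᵐ[volume] BiharmonicCritical.twoPeak (α ε) (y ε) (l ε) (v ε) → ∀ x, 0 < w x := by
    filter_upwards [BiharmonicCritical.eventually_half_le_one_add_mul K hKb,
      hCv0.eventually (Iio_mem_nhds hδ), hCv0.eventually (Iio_mem_nhds hc),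
      eventually_all.2 fun j => (hα j).eventually (Ioi_mem_nhds (by norm_num : (1 / 2 : ℝ) < 1)),
      eventually_all.2 fun j => (hl j).eventually (eventually_gt_atTop 0)]
      with ε hk hvδ hvc hα' hl' hε
    have hαhalf : ∀ j, 1 / 2 ≤ α ε j := fun j => le_of_lt (hα' j)
    set u := BiharmonicCritical.twoPeak (α ε) (y ε) (l ε) (v ε) with hu
    obtain ⟨gv, hgv⟩ := hv ε hε
    obtain ⟨g, hg⟩ := (hcrit ε hε).1
    have hKm : AEStronglyMeasurable K volume := hK.continuous.aestronglyMeasurable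
    have hkm : AEStronglyMeasurable (fun x => 1 + ε * K x) volume :=
      aestronglyMeasurable_const.add (hKm.const_mul ε)
    have hkabs : ∀ᵐ x, |1 + ε * K x| ≤ 2 := by
      filter_upwards [hk] with x hx
      rw [abs_of_nonneg (by linarith [hx.1])]
      exact hx.2
    have hsol : BiharmonicCritical.IsWeakSolution (fun x => 1 + ε * K x) u g :=
      ⟨hg, fun φ h hφ => (hcrit ε hε).weak_equation hN hKm hkabs hg hφ⟩
    have hvn : (eLpNorm (v ε) (BiharmonicCritical.critExpENN N) volume).toReal ≤
        C * BiharmonicCritical.normD22 (v ε) := by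
      have h1 := ENNReal.toReal_mono (ENNReal.mul_ne_top ENNReal.coe_ne_top hgv.2.1.2.ne)
        (hC _ _ hgv)
      rw [hgv.normD22_eq hN]
      simpa using h1
    have hneg : (eLpNorm (BiharmonicCritical.negPart u)
        (BiharmonicCritical.critExpENN N) volume).toReal < δ := by
      refine lt_of_le_of_lt (ENNReal.toReal_mono hgv.1.2.ne (eLpNorm_mono fun x => ?_))
        (hvn.trans_lt hvδ)
      rw [Real.norm_of_nonneg (BiharmonicCritical.negPart_nonneg u x), Real.norm_eq_abs]
      exact BiharmonicCritical.negPart_twoPeak_le hN (fun j => by linarith [hαhalf j]) _ hl' _ x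
    have hnn := hpos _ u g hkm hk hsol hneg
    refine hsol.pos_of_nonneg hN ?_ hnn fun h0 => ?_
    · filter_upwards [hk] with x hx
      linarith [hx.1]
    -- If u vanished, v would cancel the bubbles, so |v| would be at least half of the first one and
    -- its L^q norm at least c.
    · have := hlow (y ε 0) (l ε 0) (hl' 0) (v ε) hgv.1 (by
        filter_upwards [h0] with x hx
        exact BiharmonicCritical.bubble_le_of_twoPeak_eq_zero hN hαhalf hl' hx)
      exact absurd (this.trans hvn) (not_le.2 hvc)
  obtain ⟨ε₂, hε₂, hsub⟩ := mem_nhdsGT_iff_exists_Ioo_subset.1 hev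
  refine ⟨min ε₁ ε₂, ⟨lt_min hε₁ hε₂, min_le_left _ _⟩, fun ε hε => ?_⟩
  exact hsub ⟨hε.1, hε.2.trans_le (min_le_right _ _)⟩ ⟨hε.1, hε.2.trans_le (min_le_left _ _)⟩
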